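/- Let $d\in\mathbb N$ and let $\chi\in\mathcal D(\mathbb R^d)$, $\varphi\in\mathcal D(\mathbb R^d\setminus\{0\})$ be radial nonnegative functions such that $\chi(\xi)+\sum_{q\ge 0}\varphi(2^{-q}\xi)=1$ for all $\xi$, $\operatorname{supp}\chi\cap\operatorname{supp}\varphi(2^{-q}\cdot)=\varnothing$ for $q\ge 1$, and $\operatorname{supp}\varphi(2^{-p}\cdot)\cap\operatorname{supp}\varphi(2^{-q}\cdot)=\varnothing$ for $|p-q|\ge 2$. For $f\in\mathcal S'(\mathbb R^d)$ put $\Delta_{-1}f=\chi(\mathrm D)f$ and $\Delta_qf=\varphi(2^{-q}\mathrm D)f$ for $q\ge 0$, where $\mathrm D=-i\nabla$. Then there is a constant $C$, depending only on $d$, $\chi$ and $\varphi$, such that the following holds. Let $v=(v_1,\dots,v_d)$ be a vector field on $\mathbb R^d$ with (real or complex) tempered distributions as components, such that $\operatorname{div}v=0$ and such that its vorticity $\omega=\operatorname{curl}v=(\partial_iv_j-\partial_jv_i)_{i,j}$ belongs to $L^\infty$, and let $u$ be a bounded (real- or complex-valued) $C^\infty$ function on $\mathbb R^d$. Then the distribution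 $v\cdot\nabla u=\sum_iv_i\,\partial_iu$ is tempered and, for every integer $q\ge -1$, $\Delta_qu$ is smooth, the distribution $v\cdot\nabla\Delta_qu$ is tempered, and the commutator $[\Delta_q,v\cdot\nabla]u=\Delta_q(v\cdot\nabla u)-v\cdot\nabla\Delta_qu$ satisfies $$\big\|[\Delta_q,v\cdot\nabla]u\big\|_{L^\infty}\le C\,\|u\|_{L^\infty}\Big(\|\nabla\Delta_{-1}v\|_{L^\infty}+(q+2)\|\omega\|_{L^\infty}\Big).$$ Here $\|\cdot\|_{L^\infty}$ is $\infty$ for a distribution that is not a bounded function, $0\cdot\infty=0$, and the norm of a matrix-valued function is the maximum of the norms of its entries. -/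

import Mathlib

open MeasureTheory
open scoped SchwartzMap LineDeriv NNReal ENNReal

noncomputable section

namespace LittlewoodPaley

/-- Euclidean space `ℝ^d`. -/
abbrev E (d : ℕ) : Type := EuclideanSpace ℝ (Fin d)

/-- The `i`-th vector of the standard basis of `ℝ^d`. -/
def e {d : ℕ} (i : Fin d) : E d := EuclideanSpace.single i (1 : ℝ)

/-- A dyadic partition of unity on `ℝ^d`: two radial nonnegative functions `χ ∈ 𝓓(ℝ^d)` and
`φ ∈ 𝓓(ℝ^d ∖ {0})` with `χ(ξ) + ∑_{q ≥ 0} φ(2^{-q} ξ) = 1`, and with the usual disjointness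
of (closed) supports. -/
structure DyadicPartition (d : ℕ) where
  /-- the low frequency cut-off -/
  χ : E d → ℝ
  /-- the cut-off to a dyadic shell -/
  φ : E d → ℝ
  χ_smooth : ContDiff ℝ ((⊤ : ℕ∞) : WithTop ℕ∞) χ
  φ_smooth : ContDiff ℝ ((⊤ : ℕ∞) : WithTop ℕ∞) φ
  χ_compact : HasCompactSupport χ
  φ_compact : HasCompactSupport φ
  φ_away : (0 : E d) ∉ tsupport φ
  χ_radial : ∀ ξ η : E d, ‖ξ‖ = ‖η‖ → χ ξ = χ η
  φ_radial : ∀ ξ η : E d, ‖ξ‖ = ‖η‖ → φ ξ = φ η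
  χ_nonneg : ∀ ξ, 0 ≤ χ ξ
  φ_nonneg : ∀ ξ, 0 ≤ φ ξ
  sum_eq_one : ∀ ξ : E d, HasSum (fun q : ℕ => φ ((2 : ℝ) ^ (-(q : ℤ)) • ξ)) (1 - χ ξ)
  χ_disjoint : ∀ q : ℕ, 1 ≤ q →
    Disjoint (tsupport χ) (tsupport fun ξ => φ ((2 : ℝ) ^ (-(q : ℤ)) • ξ))
  φ_disjoint : ∀ p q : ℤ, 2 ≤ |p - q| →
    Disjoint (tsupport fun ξ => φ ((2 : ℝ) ^ (-p) • ξ)) (tsupport fun ξ => φ ((2 : ℝ) ^ (-q) • ξ))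

namespace DyadicPartition

variable {d : ℕ} (D : DyadicPartition d)

/-- The symbol of `Δ_q`: `χ` for `q = -1`, `φ(2^{-q} ·)` for `q ≥ 0`
(and `0` for the remaining integers, which are never used). -/
def symbol (q : ℤ) (ξ : E d) : ℝ :=
  if q = -1 then D.χ ξ else if 0 ≤ q then D.φ ((2 : ℝ) ^ (-q) • ξ) else 0

/-- The operator `Δ_q = m_q(D)` on tempered distributions, where `m_q` is the symbol above and
`D = -i∇`. The Fourier transform of Mathlib is `∫ exp(-2πi x·ξ) f(x) dx`, so that `D` is the
Fourier multiplier `2πξ`. -/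
def block (q : ℤ) : 𝓢'(E d, ℂ) →L[ℂ] 𝓢'(E d, ℂ) :=
  TemperedDistribution.fourierMultiplierCLM ℂ
    (fun ξ : E d => ((D.symbol q ((2 * Real.pi) • ξ) : ℝ) : ℂ))

end DyadicPartition

variable {d : ℕ}

/-- The norm of `L^∞(ℝ^d)` on tempered distributions: the essential supremum of the bounded
function which represents `T`, and `∞` if there is no such function. -/
def linftyNorm (T : 𝓢'(E d, ℂ)) : ℝ≥0∞ :=
  ⨅ (f : Lp ℂ ⊤ (volume : Measure (E d))) (_ : Lp.toTemperedDistribution f = T), ‖f‖ₑ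

/-- The `L^∞` norm of a matrix of tempered distributions (maximum over the entries). -/
def linftyMatrixNorm (M : Fin d → Fin d → 𝓢'(E d, ℂ)) : ℝ≥0∞ :=
  ⨆ (i : Fin d) (j : Fin d), linftyNorm (M i j)

/-- The divergence `∑ i, ∂_i v_i` of a vector field, in the sense of distributions. -/
def divergence (v : Fin d → 𝓢'(E d, ℂ)) : 𝓢'(E d, ℂ) :=
  ∑ i, ∂_{e i} (v i)

/-- The vorticity of a vector field on `ℝ^d`, in the sense of distributions: the antisymmetric
matrix `(∂_i v_j - ∂_j v_i)`. -/
def curl (v : Fin d → 𝓢'(E d, ℂ)) (i j : Fin d) : 𝓢'(E d, ℂ) :=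
  ∂_{e i} (v j) - ∂_{e j} (v i)

/-- The gradient `(∂_i v_j)` of a vector field, in the sense of distributions. -/
def grad (v : Fin d → 𝓢'(E d, ℂ)) (i j : Fin d) : 𝓢'(E d, ℂ) :=
  ∂_{e i} (v j)

/-- `T` is given by a smooth function `w`, and `P` is the tempered distribution `v · ∇w`.
Each product `v_i ∂_i w` of a distribution and a smooth function is taken in the sense of
distributions, `⟨v_i ∂_i w, ψ⟩ = ⟨v_i, ψ ∂_i w⟩` for test functions `ψ ∈ 𝓓(ℝ^d)`. As `𝓓` is dense
in `𝓢`, there is at most one such `P`. -/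
def IsAdvection (v : Fin d → 𝓢'(E d, ℂ)) (T P : 𝓢'(E d, ℂ)) : Prop :=
  ∃ w : E d → ℂ, ContDiff ℝ ((⊤ : ℕ∞) : WithTop ℕ∞) w ∧
    (∀ ψ : 𝓢(E d, ℂ), HasCompactSupport ψ → T ψ = ∫ x, ψ x * w x) ∧
    ∀ (ψ : 𝓢(E d, ℂ)) (ρ : Fin d → 𝓢(E d, ℂ)), HasCompactSupport ψ →
      (∀ i x, ρ i x = ψ x * fderiv ℝ w x (e i)) → P ψ = ∑ i, v i (ρ i)

end LittlewoodPaley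

end

/-! The commutator of `Δ_q` and `v · ∇` is estimated directly on its kernel, without a paraproduct
decomposition. Write `k` for the kernel of `Δ_q`. As `div v = 0`, the product `v · ∇u` is
`∑ i, ∂_i (v_i u)`, and the derivatives in `Δ_q (v · ∇u)` and in `v · ∇(Δ_q u)` all fall on `k`:

`[Δ_q, v · ∇] u (x) = ∑ i, ∫ (∂_i k) (x - y) (v_i y - v_i x) u y dy`

(`represents_commutator`). The first moment of `|∂_i k|` is bounded uniformly in `q`, and its
integral is `O(2^q)`. Hence the claim follows (`norm_conv_mul_sub_mul_conv_le`,
`boundedBy_commutator`) once `v` is the sum of a Lipschitz function with constant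
`O(‖∇Δ_{-1} v‖ + (q + 1) ‖ω‖)` and of a function which is `O(2^{-q} ‖ω‖)`: this is
`exists_velocity_modulus`.

That splitting is the one into low and high frequencies. The Laplacian of `v_j` is
`∑ i, ∂_i ω_{ij}` as `div v = 0`, which on a dyadic shell can be inverted by a multiplier with
smooth symbol (`block_eq_sum_curl`). By dilation, `Δ_p v` is `O(2^{-p} ‖ω‖)` and `∇Δ_p v` is
`O(‖ω‖)` for all `p ≥ 0`. So the frequencies from `2^{q+1}` on have a sum which is
`O(2^{-q} ‖ω‖)`, and each of the `q + 1` blocks below contributes `O(‖ω‖)` to the gradient of the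
rest.

Two points need care because `v` is only a tempered distribution. It has to be a function for the
kernel formula to make sense: the blocks `Δ_p v` with `p ≥ 0` are bounded functions with a summable
series, and `Δ_{-1} v` is a function of polynomial growth in the mean since it is continuous for a
weighted `L^2` norm on test functions, where the Riesz representation theorem applies
(`exists_represents_fourierMultiplier`). And a function whose distributional gradient is bounded is
Lipschitz outside a null set, as the limit of its mollifications (`Represents.exists_lipschitz`). -/

namespace LittlewoodPaley

set_option linter.unusedSectionVars false

section

variable {V : Type} [NormedAddCommGroup V] [InnerProductSpace ℝ V] [FiniteDimensional ℝ V]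
  [MeasurableSpace V] [BorelSpace V]

/-! ### Functions which define tempered distributions -/

/-- A measurable function on `V` which becomes integrable after division by a power of `1 + ‖x‖`.
Such a function defines a tempered distribution, and the class is stable under multiplication by
bounded functions. -/
def TemperedFun (f : V → ℂ) : Prop :=
  ∃ M : ℕ, Integrable (fun x => ((1 + ‖x‖) ^ M)⁻¹ • f x)

theorem one_add_norm_pow_pos (x : V) (M : ℕ) : 0 < (1 + ‖x‖) ^ M := by positivity

theorem exists_one_add_norm_pow_mul_le {F : Type*} [NormedAddCommGroup F] [NormedSpace ℝ F]
    (ψ : 𝓢(V, F)) (M : ℕ) : ∃ C, 0 < C ∧ ∀ x, (1 + ‖x‖) ^ M * ‖ψ x‖ ≤ C := by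
  refine ⟨2 ^ M * (Finset.Iic (M, 0)).sup (fun m => SchwartzMap.seminorm ℝ m.1 m.2) ψ + 1,
    by positivity, fun x => ?_⟩
  have := SchwartzMap.one_add_le_sup_seminorm_apply (𝕜 := ℝ) (m := (M, 0)) le_rfl le_rfl ψ x
  rw [norm_iteratedFDeriv_zero] at this
  exact this.trans (by simp)

namespace TemperedFun

variable {f g : V → ℂ}

theorem aestronglyMeasurable (hf : TemperedFun f) : AEStronglyMeasurable f volume := by
  obtain ⟨M, hM⟩ := hf
  have : f = fun x => ((1 + ‖x‖) ^ M) • (((1 + ‖x‖) ^ M)⁻¹ • f x) := by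
    ext x
    rw [smul_inv_smul₀ (one_add_norm_pow_pos x M).ne']
  rw [this]
  have hc : Continuous fun x : V => (1 + ‖x‖) ^ M := by fun_prop
  exact hc.aestronglyMeasurable.smul hM.1

theorem integrable_of_le {M N : ℕ} (h : M ≤ N)
    (hM : Integrable (fun x : V => ((1 + ‖x‖) ^ M)⁻¹ • f x)) :
    Integrable (fun x => ((1 + ‖x‖) ^ N)⁻¹ • f x) := by
  refine hM.mono ?_ (.of_forall fun x => ?_)
  · have := (aestronglyMeasurable ⟨M, hM⟩)
    refine AEStronglyMeasurable.smul (𝕜 := ℝ) ?_ this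
    refine Continuous.aestronglyMeasurable (Continuous.inv₀ (by fun_prop) fun x => ?_)
    exact (one_add_norm_pow_pos x N).ne'
  · rw [norm_smul, norm_smul]
    gcongr
    rw [Real.norm_of_nonneg (by positivity), Real.norm_of_nonneg (by positivity)]
    gcongr
    simp

theorem add (hf : TemperedFun f) (hg : TemperedFun g) : TemperedFun (fun x => f x + g x) := by
  obtain ⟨M, hM⟩ := hf
  obtain ⟨N, hN⟩ := hg
  refine ⟨max M N, ?_⟩
  simp_rw [smul_add]
  exact (integrable_of_le (le_max_left M N) hM).add (integrable_of_le (le_max_right M N) hN)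

theorem mul_bounded (hf : TemperedFun f) (hg : AEStronglyMeasurable g volume) {B : ℝ}
    (hB : ∀ᵐ x, ‖g x‖ ≤ B) : TemperedFun (fun x => f x * g x) := by
  obtain ⟨M, hM⟩ := hf
  refine ⟨M, ?_⟩
  simp_rw [← smul_mul_assoc]
  exact hM.mul_bdd hg hB

theorem neg (hf : TemperedFun f) : TemperedFun (fun x => - f x) := by
  obtain ⟨M, hM⟩ := hf
  refine ⟨M, ?_⟩
  simp_rw [smul_neg]
  exact hM.neg

theorem congr (hf : TemperedFun f) (h : f =ᵐ[volume] g) : TemperedFun g := by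
  obtain ⟨M, hM⟩ := hf
  refine ⟨M, hM.congr ?_⟩
  filter_upwards [h] with x hx
  rw [hx]

theorem of_bounded (hf : AEStronglyMeasurable f volume) {B : ℝ} (hB : ∀ᵐ x, ‖f x‖ ≤ B) :
    TemperedFun f := by
  have h1 : TemperedFun (fun _ : V => (1 : ℂ)) := by
    refine ⟨(volume : Measure V).integrablePower, ?_⟩
    have := (volume : Measure V).integrable_pow_neg_integrablePower
    have h2 := this.ofReal (𝕜 := ℂ)
    refine h2.congr (.of_forall fun x => ?_)
    simp [Real.rpow_neg (show 0 ≤ 1 + ‖x‖ by positivity)]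
  simpa using h1.mul_bounded hf hB

theorem pow_mul (hf : TemperedFun f) (N : ℕ) : TemperedFun (fun x => (1 + ‖x‖ : ℂ) ^ N * f x) := by
  obtain ⟨M, hM⟩ := hf
  refine ⟨M + N, hM.congr (.of_forall fun x => ?_)⟩
  have : (1 + ‖x‖ : ℂ) ≠ 0 := by
    have : (0 : ℝ) < 1 + ‖x‖ := by positivity
    exact_mod_cast this.ne'
  simp only [Complex.real_smul]
  push_cast
  field_simp
  ring

theorem zero : TemperedFun (fun _ : V => (0 : ℂ)) := ⟨0, by simp⟩

theorem finset_sum {ι : Type*} {s : Finset ι} {F : ι → V → ℂ} (h : ∀ i ∈ s, TemperedFun (F i)) :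
    TemperedFun (fun x => ∑ i ∈ s, F i x) := by
  classical
  induction s using Finset.induction_on with
  | empty => simpa using zero
  | insert a s ha ih =>
    simp_rw [Finset.sum_insert ha]
    exact (h a (by simp)).add (ih fun i hi => h i (by simp [hi]))

/-- The bound behind the continuity of the distribution which `f` defines. -/
theorem norm_mul_le {M : ℕ} {ψ : V → ℂ} {C : ℝ} (hψ : ∀ x, (1 + ‖x‖) ^ M * ‖ψ x‖ ≤ C) (x : V) :
    ‖ψ x * f x‖ ≤ C * ‖((1 + ‖x‖) ^ M)⁻¹ • f x‖ := by
  have := one_add_norm_pow_pos x M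
  rw [norm_smul, Real.norm_of_nonneg (by positivity), norm_mul]
  calc ‖ψ x‖ * ‖f x‖ = ((1 + ‖x‖) ^ M * ‖ψ x‖) * (((1 + ‖x‖) ^ M)⁻¹ * ‖f x‖) := by
        field_simp
    _ ≤ _ := by gcongr; exact hψ x

theorem integrable_mul (hf : TemperedFun f) (ψ : 𝓢(V, ℂ)) : Integrable (fun x => ψ x * f x) := by
  have hm := hf.aestronglyMeasurable
  obtain ⟨M, hM⟩ := hf
  obtain ⟨C, -, hC⟩ := exists_one_add_norm_pow_mul_le ψ M
  exact (hM.norm.const_mul C).mono' (ψ.continuous.aestronglyMeasurable.mul hm)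
    (.of_forall fun x => norm_mul_le hC x)

theorem locallyIntegrable (hf : TemperedFun f) : LocallyIntegrable f volume := by
  obtain ⟨M, hM⟩ := hf
  have h := hM.locallyIntegrable.continuous_smul (𝕜 := ℝ)
    (by fun_prop : Continuous fun x : V => (1 + ‖x‖) ^ M)
  refine h.congr (.of_forall fun x => ?_)
  exact smul_inv_smul₀ (one_add_norm_pow_pos x M).ne' (f x)

end TemperedFun

/-- The tempered distribution `T` is integration against the function `f`. The growth condition on
`f` is part of the definition, so that all the integrals converge. -/
def Represents (f : V → ℂ) (T : 𝓢'(V, ℂ)) : Prop :=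
  TemperedFun f ∧ ∀ ψ : 𝓢(V, ℂ), T ψ = ∫ x, ψ x * f x

theorem TemperedFun.exists_represents {f : V → ℂ} (hf : TemperedFun f) :
    ∃ T : 𝓢'(V, ℂ), Represents f T := by
  have hf' := hf
  obtain ⟨M, hM⟩ := hf'
  let L : 𝓢(V, ℂ) →L[ℂ] ℂ := SchwartzMap.mkCLMtoNormedSpace (fun ψ => ∫ x, ψ x * f x)
    (fun ψ θ => by
      simp only [add_apply, add_mul]
      exact integral_add (hf.integrable_mul ψ) (hf.integrable_mul θ))
    (fun a ψ => by
      simp only [smul_apply, smul_eq_mul, mul_assoc, RingHom.id_apply]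
      exact integral_const_mul _ _)
    ⟨Finset.Iic (M, 0), 2 ^ M * ∫ x, ‖((1 + ‖x‖) ^ M)⁻¹ • f x‖, by positivity, fun ψ => by
      have hb : ∀ x, (1 + ‖x‖) ^ M * ‖ψ x‖ ≤
          2 ^ M * (Finset.Iic (M, 0)).sup (schwartzSeminormFamily ℂ V ℂ) ψ := fun x => by
        have := SchwartzMap.one_add_le_sup_seminorm_apply (𝕜 := ℂ) (m := (M, 0)) le_rfl le_rfl ψ x
        rwa [norm_iteratedFDeriv_zero] at this
      refine (norm_integral_le_integral_norm _).trans ?_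
      refine (integral_mono (hf.integrable_mul ψ).norm (hM.norm.const_mul _)
        fun x => TemperedFun.norm_mul_le hb x).trans ?_
      rw [integral_const_mul]
      exact le_of_eq (by ring)⟩
  exact ⟨ContinuousLinearMap.toPointwiseConvergenceCLM ℂ (RingHom.id ℂ) 𝓢(V, ℂ) ℂ L, hf,
    fun ψ => rfl⟩

namespace Represents

variable {f g : V → ℂ} {S T : 𝓢'(V, ℂ)}

theorem add (hf : Represents f S) (hg : Represents g T) :
    Represents (fun x => f x + g x) (S + T) := by
  refine ⟨hf.1.add hg.1, fun ψ => ?_⟩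
  simp only [mul_add]
  rw [integral_add (hf.1.integrable_mul ψ) (hg.1.integrable_mul ψ), ← hf.2, ← hg.2]
  rfl

theorem neg (hf : Represents f S) : Represents (fun x => - f x) (-S) := by
  refine ⟨hf.1.neg, fun ψ => ?_⟩
  simp only [mul_neg]
  rw [integral_neg, ← hf.2]
  rfl

theorem sub (hf : Represents f S) (hg : Represents g T) :
    Represents (fun x => f x - g x) (S - T) := by
  simpa [sub_eq_add_neg] using hf.add hg.neg

theorem zero : Represents (fun _ : V => (0 : ℂ)) 0 := by
  refine ⟨TemperedFun.zero, fun ψ => ?_⟩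
  simp

theorem finset_sum {ι : Type*} {s : Finset ι} {F : ι → V → ℂ} {T : ι → 𝓢'(V, ℂ)}
    (h : ∀ i ∈ s, Represents (F i) (T i)) :
    Represents (fun x => ∑ i ∈ s, F i x) (∑ i ∈ s, T i) := by
  classical
  induction s using Finset.induction_on with
  | empty => simpa using zero
  | insert a s ha ih =>
    simp_rw [Finset.sum_insert ha]
    exact (h a (by simp)).add (ih fun i hi => h i (by simp [hi]))

theorem congr_ae (hf : Represents f T) (h : f =ᵐ[volume] g) : Represents g T := by
  refine ⟨hf.1.congr h, fun ψ => ?_⟩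
  rw [hf.2]
  refine integral_congr_ae ?_
  filter_upwards [h] with x hx
  rw [hx]

/-- The function which represents a distribution is unique. -/
theorem ae_eq (hf : Represents f T) (hg : Represents g T) : f =ᵐ[volume] g := by
  have h := hf.sub hg
  rw [sub_self] at h
  have h0 : ∀ᵐ x, f x - g x = 0 := by
    refine ae_eq_zero_of_integral_contDiff_smul_eq_zero h.1.locallyIntegrable ?_
    intro θ hθ hc
    have hc' : HasCompactSupport (Complex.ofRealCLM ∘ θ) := hc.comp_left rfl
    have hs : ContDiff ℝ ((⊤ : ℕ∞) : WithTop ℕ∞) (Complex.ofRealCLM ∘ θ) := by fun_prop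
    have := h.2 (hc'.toSchwartzMap hs)
    simpa using this.symm
  filter_upwards [h0] with x hx using sub_eq_zero.1 hx

end Represents

theorem ae_norm_le_norm_Lp (f : Lp ℂ ⊤ (volume : Measure V)) : ∀ᵐ x, ‖f x‖ ≤ ‖f‖ := by
  filter_upwards [ae_le_eLpNormEssSup (f := f) (μ := volume)] with x hx
  rw [Lp.norm_def, eLpNorm_exponent_top, ← toReal_enorm]
  refine ENNReal.toReal_mono ?_ hx
  rw [← eLpNorm_exponent_top]
  exact Lp.eLpNorm_ne_top f

theorem represents_toTemperedDistribution (f : Lp ℂ ⊤ (volume : Measure V)) :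
    Represents f (Lp.toTemperedDistribution f) :=
  ⟨TemperedFun.of_bounded (Lp.aestronglyMeasurable f) (ae_norm_le_norm_Lp f), fun ψ => by simp⟩

/-! ### Bounded tempered distributions -/

/-- The tempered distribution `T` is a measurable function bounded by `B` almost everywhere. -/
def BoundedBy (T : 𝓢'(V, ℂ)) (B : ℝ) : Prop :=
  ∃ f, Represents f T ∧ ∀ᵐ x, ‖f x‖ ≤ B

namespace BoundedBy

variable {S T : 𝓢'(V, ℂ)} {A B : ℝ}

theorem add (hS : BoundedBy S A) (hT : BoundedBy T B) : BoundedBy (S + T) (A + B) := by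
  obtain ⟨f, hf, hfA⟩ := hS
  obtain ⟨g, hg, hgB⟩ := hT
  refine ⟨_, hf.add hg, ?_⟩
  filter_upwards [hfA, hgB] with x h1 h2 using (norm_add_le _ _).trans (add_le_add h1 h2)

theorem zero : BoundedBy (0 : 𝓢'(V, ℂ)) 0 := ⟨_, Represents.zero, by simp⟩

theorem smul (hT : BoundedBy T B) (a : ℂ) : BoundedBy (a • T) (‖a‖ * B) := by
  obtain ⟨f, hf, hB⟩ := hT
  refine ⟨fun x => f x * a, ⟨hf.1.mul_bounded aestronglyMeasurable_const (B := ‖a‖) (by simp),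
    fun ψ => ?_⟩, ?_⟩
  · change a • T ψ = _
    rw [hf.2, smul_eq_mul, ← integral_const_mul]
    exact integral_congr_ae (.of_forall fun x => by ring)
  · filter_upwards [hB] with x hx
    rw [norm_mul, mul_comm]
    gcongr

theorem mono (hS : BoundedBy S A) (h : A ≤ B) : BoundedBy S B := by
  obtain ⟨f, hf, hfA⟩ := hS
  exact ⟨f, hf, hfA.mono fun x hx => hx.trans h⟩

theorem finset_sum {ι : Type*} {s : Finset ι} {T : ι → 𝓢'(V, ℂ)} {B : ι → ℝ}
    (h : ∀ i ∈ s, BoundedBy (T i) (B i)) : BoundedBy (∑ i ∈ s, T i) (∑ i ∈ s, B i) := by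
  classical
  induction s using Finset.induction_on with
  | empty => simpa using zero
  | insert a s ha ih =>
    simp_rw [Finset.sum_insert ha]
    exact (h a (by simp)).add (ih fun i hi => h i (by simp [hi]))

theorem exists_Lp (h : BoundedBy T B) : ∃ f : Lp ℂ ⊤ (volume : Measure V),
    Lp.toTemperedDistribution f = T ∧ ‖f‖ ≤ max B 0 := by
  obtain ⟨f, hf, hB⟩ := h
  have hm : MemLp f ⊤ volume := memLp_top_of_bound hf.1.aestronglyMeasurable B hB
  refine ⟨hm.toLp f, ?_, ?_⟩
  · ext ψ
    rw [hf.2, (represents_toTemperedDistribution _).2]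
    refine integral_congr_ae ?_
    filter_upwards [hm.coeFn_toLp] with x hx
    rw [hx]
  · rw [Lp.norm_toLp]
    refine ENNReal.toReal_le_of_le_ofReal (le_max_right _ _) ?_
    rw [eLpNorm_exponent_top]
    refine eLpNormEssSup_le_of_ae_bound ?_
    filter_upwards [hB] with x hx using hx.trans (le_max_left _ _)

end BoundedBy

end

variable {d : ℕ}

theorem BoundedBy.linftyNorm_le {T : 𝓢'(E d, ℂ)} {B : ℝ} (h : BoundedBy T B) (hB : 0 ≤ B) :
    linftyNorm T ≤ ENNReal.ofReal B := by
  obtain ⟨f, hf, hn⟩ := h.exists_Lp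
  refine (iInf₂_le f hf).trans ?_
  rw [max_eq_left hB] at hn
  rw [← ofReal_norm]
  exact ENNReal.ofReal_le_ofReal hn

theorem boundedBy_of_linftyNorm_lt_top {T : 𝓢'(E d, ℂ)} (h : linftyNorm T < ⊤) :
    BoundedBy T (linftyNorm T).toReal := by
  simp only [linftyNorm, iInf_lt_iff] at h
  obtain ⟨f, hf, -⟩ := h
  have hr := represents_toTemperedDistribution f
  rw [hf] at hr
  have hn : linftyNorm T = ‖f‖ₑ := by
    refine le_antisymm (iInf₂_le f hf) (le_iInf₂ fun g hg => ?_)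
    have hg' := represents_toTemperedDistribution g
    rw [hg] at hg'
    rw [Lp.ext (hr.ae_eq hg')]
  refine ⟨f, hr, ?_⟩
  rw [hn]
  rw [toReal_enorm]
  exact ae_norm_le_norm_Lp f

section

variable {V : Type} [NormedAddCommGroup V] [InnerProductSpace ℝ V] [FiniteDimensional ℝ V]
  [MeasurableSpace V] [BorelSpace V]

open FourierTransform

/-! ### Fourier multipliers as convolution operators -/

/-- The convolution `k * f` (with the junk value `0` at the points where the integral diverges). -/
noncomputable def conv (k f : V → ℂ) (x : V) : ℂ := ∫ y, k (x - y) * f y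

/-- The transpose of the multiplier `G(D)` is convolution with the reflected kernel. -/
theorem fourier_mul_fourierInv_apply (G ψ : 𝓢(V, ℂ)) (y : V) :
    𝓕 (SchwartzMap.smulLeftCLM ℂ G (𝓕⁻ ψ)) y = ∫ x, (𝓕⁻ G) (x - y) * ψ x := by
  have hH : Integrable (fun ξ => Real.fourierChar (-inner ℝ ξ y) • G ξ) := by
    have := (Real.fourierIntegral_convergent_iff (μ := volume) (f := G) y).2 G.integrable
    exact this
  have key := VectorFourier.integral_fourierIntegral_smul_eq_flip (μ := (volume : Measure V))
    (ν := (volume : Measure V)) (L := -innerₗ V) Real.continuous_fourierChar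
    (continuous_inner (𝕜 := ℝ) (E := V)).neg ψ.integrable hH
  rw [SchwartzMap.fourier_coe, Real.fourier_eq]
  have h1 : ∀ ξ, VectorFourier.fourierIntegral Real.fourierChar volume (-innerₗ V) ψ ξ
      = (𝓕⁻ ψ) ξ := fun ξ => by
    rw [SchwartzMap.fourierInv_coe]; rfl
  have h2 : ∀ x, VectorFourier.fourierIntegral Real.fourierChar volume (-innerₗ V).flip
      (fun ξ => Real.fourierChar (-inner ℝ ξ y) • G ξ) x = (𝓕⁻ G) (x - y) := fun x => by
    rw [SchwartzMap.fourierInv_coe, Real.fourierInv_eq]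
    refine integral_congr_ae (.of_forall fun ξ => ?_)
    simp only [smul_smul]
    rw [← AddChar.map_add_eq_mul]
    congr 2
    rw [inner_sub_right, real_inner_comm x ξ]
    simp [sub_eq_add_neg]
  simp_rw [h1, h2] at key
  calc _ = ∫ ξ, (𝓕⁻ ψ) ξ • Real.fourierChar (-inner ℝ ξ y) • G ξ := by
        refine integral_congr_ae (.of_forall fun ξ => ?_)
        simp only [SchwartzMap.smulLeftCLM_apply_apply G.hasTemperateGrowth, smul_eq_mul,
          Circle.smul_def]
        ring
    _ = _ := by
        rw [key]
        exact integral_congr_ae (.of_forall fun x => by simp [mul_comm])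

/-- Peetre's inequality. -/
theorem one_add_norm_pow_le_mul (x y : V) (M : ℕ) :
    (1 + ‖y‖) ^ M ≤ (1 + ‖x - y‖) ^ M * (1 + ‖x‖) ^ M := by
  rw [← mul_pow]
  gcongr
  have : ‖y‖ ≤ ‖x‖ + ‖x - y‖ := by
    calc ‖y‖ = ‖x - (x - y)‖ := by simp
      _ ≤ _ := norm_sub_le _ _
  nlinarith [norm_nonneg x, norm_nonneg (x - y)]

/-- The integrability which allows to exchange the integrals when a convolution is paired
with `ψ`. -/
theorem integrable_prod_conv (k : 𝓢(V, ℂ)) {ψ f : V → ℂ} {M : ℕ}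
    (hf : Integrable (fun x => ((1 + ‖x‖) ^ M)⁻¹ • f x))
    (hψ : Integrable (fun x => (1 + ‖x‖) ^ M • ψ x)) :
    Integrable (fun p : V × V => ψ p.1 * (k (p.1 - p.2) * f p.2))
      ((volume : Measure V).prod volume) := by
  have hfm : AEStronglyMeasurable f volume := TemperedFun.aestronglyMeasurable ⟨M, hf⟩
  have hψm : AEStronglyMeasurable ψ volume := by
    have : ψ = fun x => ((1 + ‖x‖) ^ M)⁻¹ • ((1 + ‖x‖) ^ M • ψ x) := by
      ext x
      rw [inv_smul_smul₀ (one_add_norm_pow_pos x M).ne']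
    rw [this]
    refine AEStronglyMeasurable.smul (𝕜 := ℝ) ?_ hψ.1
    refine Continuous.aestronglyMeasurable (Continuous.inv₀ (by fun_prop) fun x => ?_)
    exact (one_add_norm_pow_pos x M).ne'
  obtain ⟨C, hC0, hC⟩ := exists_one_add_norm_pow_mul_le k M
  refine ((hψ.norm.mul_prod hf.norm).const_mul C).mono' ?_ (.of_forall fun p => ?_)
  · refine hψm.comp_fst.mul (AEStronglyMeasurable.mul ?_ hfm.comp_snd)
    exact (k.continuous.comp (by fun_prop)).aestronglyMeasurable
  · obtain ⟨x, y⟩ := p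
    have h1 := one_add_norm_pow_le_mul x y M
    have h2 := hC (x - y)
    have hy := one_add_norm_pow_pos y M
    simp only [norm_mul, norm_smul, norm_inv, norm_pow, Real.norm_of_nonneg
      (show 0 ≤ 1 + ‖x‖ by positivity), Real.norm_of_nonneg (show 0 ≤ 1 + ‖y‖ by positivity)]
    calc ‖ψ x‖ * (‖k (x - y)‖ * ‖f y‖)
        = (1 + ‖y‖) ^ M * ‖k (x - y)‖ * (‖ψ x‖ * (((1 + ‖y‖) ^ M)⁻¹ * ‖f y‖)) := by field_simp
      _ ≤ ((1 + ‖x - y‖) ^ M * (1 + ‖x‖) ^ M) * ‖k (x - y)‖ *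
          (‖ψ x‖ * (((1 + ‖y‖) ^ M)⁻¹ * ‖f y‖)) := by gcongr
      _ = ((1 + ‖x - y‖) ^ M * ‖k (x - y)‖) * ((1 + ‖x‖) ^ M *
          (‖ψ x‖ * (((1 + ‖y‖) ^ M)⁻¹ * ‖f y‖))) := by ring
      _ ≤ C * ((1 + ‖x‖) ^ M * (‖ψ x‖ * (((1 + ‖y‖) ^ M)⁻¹ * ‖f y‖))) := by gcongr
      _ = _ := by ring

theorem integrable_one_add_norm_pow_smul (ψ : 𝓢(V, ℂ)) (M : ℕ) :
    Integrable (fun x => (1 + ‖x‖) ^ M • ψ x) := by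
  have h1 : TemperedFun (fun _ : V => (1 : ℂ)) :=
    TemperedFun.of_bounded aestronglyMeasurable_const (B := 1) (by simp)
  refine ((h1.pow_mul M).integrable_mul ψ).congr (.of_forall fun x => ?_)
  simp [mul_comm]

theorem TemperedFun.temperedFun_conv {f : V → ℂ} (hf : TemperedFun f) (k : 𝓢(V, ℂ)) :
    TemperedFun (conv k f) := by
  obtain ⟨M, hM⟩ := hf
  have h1 : TemperedFun (fun _ : V => (1 : ℂ)) :=
    TemperedFun.of_bounded aestronglyMeasurable_const (B := 1) (by simp)
  obtain ⟨N, hN⟩ := h1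
  have hψ : Integrable (fun x : V => (1 + ‖x‖) ^ M • ((((1 + ‖x‖) ^ (M + N))⁻¹ : ℝ) : ℂ)) := by
    refine hN.congr (.of_forall fun x => ?_)
    have : (1 + ‖x‖ : ℂ) ≠ 0 := by
      have : (0 : ℝ) < 1 + ‖x‖ := by positivity
      exact_mod_cast this.ne'
    simp only [Complex.real_smul]
    push_cast
    field_simp
    ring
  have := (integrable_prod_conv k hM hψ).integral_prod_left
  refine ⟨M + N, this.congr (.of_forall fun x => ?_)⟩
  simp only [conv]
  rw [integral_const_mul, Complex.real_smul]

theorem TemperedFun.integrable_conv {f : V → ℂ} (hf : TemperedFun f) (k : 𝓢(V, ℂ)) (x : V) :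
    Integrable (fun y => k (x - y) * f y) := by
  have hfm := hf.aestronglyMeasurable
  obtain ⟨M, hM⟩ := hf
  obtain ⟨C, hC0, hC⟩ := exists_one_add_norm_pow_mul_le k M
  refine (hM.norm.const_mul (C * (1 + ‖x‖) ^ M)).mono'
    ((k.continuous.comp (by fun_prop)).aestronglyMeasurable.mul hfm) (.of_forall fun y => ?_)
  refine TemperedFun.norm_mul_le (ψ := fun y => k (x - y)) (fun y => ?_) y
  have h1 := one_add_norm_pow_le_mul x y M
  calc (1 + ‖y‖) ^ M * ‖k (x - y)‖ ≤ ((1 + ‖x - y‖) ^ M * (1 + ‖x‖) ^ M) * ‖k (x - y)‖ := by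
        gcongr
    _ = ((1 + ‖x - y‖) ^ M * ‖k (x - y)‖) * (1 + ‖x‖) ^ M := by ring
    _ ≤ _ := by gcongr; exact hC _

/-- On functions, the multiplier `G(D)` is convolution with `𝓕⁻ G`. -/
theorem Represents.fourierMultiplier {f : V → ℂ} {T : 𝓢'(V, ℂ)} (hf : Represents f T)
    (G : 𝓢(V, ℂ)) :
    Represents (conv (𝓕⁻ G : 𝓢(V, ℂ)) f) (TemperedDistribution.fourierMultiplierCLM ℂ G T) := by
  refine ⟨hf.1.temperedFun_conv _, fun ψ => ?_⟩
  rw [TemperedDistribution.fourierMultiplierCLM_apply_apply, hf.2]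
  obtain ⟨M, hM⟩ := hf.1
  have hint := integrable_prod_conv (𝓕⁻ G) hM (integrable_one_add_norm_pow_smul ψ M)
  calc _ = ∫ y, ∫ x, ψ x * ((𝓕⁻ G) (x - y) * f y) := by
        refine integral_congr_ae (.of_forall fun y => ?_)
        simp only [fourier_mul_fourierInv_apply]
        rw [← integral_mul_const]
        exact integral_congr_ae (.of_forall fun x => by ring)
    _ = ∫ x, ∫ y, ψ x * ((𝓕⁻ G) (x - y) * f y) := (integral_integral_swap hint).symm
    _ = _ := by
        refine integral_congr_ae (.of_forall fun x => ?_)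
        simp only [conv]
        rw [integral_const_mul]

theorem norm_conv_le {k : 𝓢(V, ℂ)} {f : V → ℂ} {B : ℝ} (hB : ∀ᵐ x, ‖f x‖ ≤ B) (x : V) :
    ‖conv k f x‖ ≤ (∫ y, ‖k y‖) * B := by
  calc ‖conv k f x‖ ≤ ∫ y, ‖k (x - y)‖ * B := by
        refine norm_integral_le_of_norm_le ((k.integrable.comp_sub_left x).norm.mul_const B) ?_
        filter_upwards [hB] with y hy
        rw [norm_mul]
        gcongr
    _ = _ := by
        rw [integral_mul_const, integral_sub_left_eq_self (fun y => ‖k y‖)]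

/-- Young's inequality: a multiplier is bounded on `L^∞` by the `L^1` norm of its kernel. -/
theorem BoundedBy.fourierMultiplier {T : 𝓢'(V, ℂ)} {B : ℝ} (hT : BoundedBy T B) (G : 𝓢(V, ℂ)) :
    BoundedBy (TemperedDistribution.fourierMultiplierCLM ℂ G T)
      ((∫ y, ‖(𝓕⁻ G : 𝓢(V, ℂ)) y‖) * B) := by
  obtain ⟨f, hf, hB⟩ := hT
  exact ⟨_, hf.fourierMultiplier G, .of_forall fun x => norm_conv_le hB x⟩

/-! ### Dilation of a symbol -/

theorem fourierInv_dilation {G H : V → ℂ} {c : ℝ} (hc : 0 < c) (h : ∀ ξ, H ξ = G (c⁻¹ • ξ))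
    (x : V) : 𝓕⁻ H x = (c ^ Module.finrank ℝ V : ℝ) • 𝓕⁻ G (c • x) := by
  rw [Real.fourierInv_eq, Real.fourierInv_eq]
  have := Measure.integral_comp_inv_smul (volume : Measure V)
    (fun ξ => Real.fourierChar (inner ℝ ξ (c • x)) • G ξ) c
  rw [abs_of_pos (by positivity)] at this
  rw [← this]
  refine integral_congr_ae (.of_forall fun ξ => ?_)
  simp only [h, inner_smul_left, inner_smul_right]
  congr 2
  simp [hc.ne']

/-- The `n`-th moment of the kernel of the dilated symbol `G(c⁻¹ ·)` scales like `c^{-n}`; in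
particular its `L^1` norm does not depend on `c`. -/
theorem integral_norm_pow_mul_fourierInv_dilation {G H : V → ℂ} {c : ℝ} (hc : 0 < c)
    (h : ∀ ξ, H ξ = G (c⁻¹ • ξ)) (n : ℕ) :
    ∫ x, ‖x‖ ^ n * ‖𝓕⁻ H x‖ = (c ^ n)⁻¹ * ∫ x, ‖x‖ ^ n * ‖𝓕⁻ G x‖ := by
  have := Measure.integral_comp_smul (volume : Measure V) (fun x => ‖x‖ ^ n * ‖𝓕⁻ G x‖) c
  rw [abs_of_pos (by positivity), smul_eq_mul] at this
  have h2 : ∫ x, ‖x‖ ^ n * ‖𝓕⁻ G x‖ =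
      c ^ Module.finrank ℝ V * ∫ x, ‖c • x‖ ^ n * ‖𝓕⁻ G (c • x)‖ := by
    rw [this]; field_simp
  rw [h2, ← integral_const_mul, ← integral_const_mul]
  refine integral_congr_ae (.of_forall fun x => ?_)
  simp only [fourierInv_dilation hc h, norm_smul, Real.norm_of_nonneg hc.le, norm_pow, mul_pow]
  field_simp

/-! ### The image of a smoothing multiplier consists of functions -/

/-- A tempered distribution has finite order. -/
theorem exists_norm_le_sup_seminorm (T : 𝓢'(V, ℂ)) :
    ∃ (s : Finset (ℕ × ℕ)) (C : ℝ), 0 ≤ C ∧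
      ∀ ψ, ‖T ψ‖ ≤ C * s.sup (schwartzSeminormFamily ℂ V ℂ) ψ := by
  let L : 𝓢(V, ℂ) →ₗ[ℂ] ℂ := { toFun := T, map_add' := map_add T, map_smul' := map_smul T }
  obtain ⟨s, C, -, h⟩ := Seminorm.bound_of_continuous (schwartz_withSeminorms ℂ V ℂ)
    ((normSeminorm ℂ ℂ).comp L) (continuous_norm.comp (map_continuous T))
  exact ⟨s, C, C.2, fun ψ => h ψ⟩

theorem integrable_one_add_norm_pow_mul_norm (ψ : 𝓢(V, ℂ)) (n : ℕ) :
    Integrable (fun x => (1 + ‖x‖) ^ n * ‖ψ x‖) := by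
  refine (integrable_one_add_norm_pow_smul ψ n).norm.congr (.of_forall fun x => ?_)
  simp only [norm_smul, norm_pow]
  rw [Real.norm_of_nonneg (by positivity)]

theorem norm_iteratedFDeriv_fourierInv_le (ψ : 𝓢(V, ℂ)) {j n : ℕ} (hj : j ≤ n) (ξ : V) :
    ‖iteratedFDeriv ℝ j (𝓕⁻ ψ : 𝓢(V, ℂ)) ξ‖ ≤ (2 * Real.pi) ^ j * ∫ x, (1 + ‖x‖) ^ n * ‖ψ x‖ := by
  have hint : ∀ k : ℕ, Integrable (fun v => ‖v‖ ^ k * ‖ψ v‖) :=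
    fun k => ψ.integrable_pow_mul volume k
  rw [SchwartzMap.fourierInv_coe, Real.fourierInv_eq_fourier_comp_neg]
  have h := Real.pow_mul_norm_iteratedFDeriv_fourier_le (f := fun x => ψ (-x)) (K := ⊤) (N := 0)
    (k := j) (n := 0) (contDiff_zero.2 (ψ.continuous.comp continuous_neg)) ?_ le_top le_rfl ξ
  · simp only [pow_zero, one_mul, mul_one, zero_add, Finset.range_one, Finset.sum_product,
      Finset.sum_singleton, norm_iteratedFDeriv_zero] at h
    refine h.trans ?_
    gcongr
    have hneg : ∀ i : ℕ, ∫ v, ‖v‖ ^ i * ‖ψ (-v)‖ = ∫ v, ‖v‖ ^ i * ‖ψ v‖ := fun i => by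
      rw [← integral_neg_eq_self (fun v => ‖v‖ ^ i * ‖ψ v‖)]
      simp
    simp_rw [hneg]
    rw [← integral_finsetSum _ fun i _ => hint i]
    refine integral_mono (integrable_finsetSum _ fun i _ => hint i)
      (integrable_one_add_norm_pow_mul_norm ψ n) fun v => ?_
    simp only [← Finset.sum_mul]
    gcongr
    calc ∑ i ∈ Finset.range (j + 1), ‖v‖ ^ i
        ≤ ∑ i ∈ Finset.range (j + 1), ‖v‖ ^ i * (1 : ℝ) ^ (j - i) * j.choose i := by
          refine Finset.sum_le_sum fun i hi => ?_
          have : (1 : ℝ) ≤ j.choose i := by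
            exact_mod_cast Nat.choose_pos (Nat.lt_succ_iff.1 (Finset.mem_range.1 hi))
          rw [one_pow, mul_one]
          exact le_mul_of_one_le_right (by positivity) this
      _ = (1 + ‖v‖) ^ j := by rw [add_comm (1 : ℝ), add_pow]
      _ ≤ (1 + ‖v‖) ^ n := pow_le_pow_right₀ (by simp) hj
  · intro k m _ hm
    obtain rfl : m = 0 := by simpa using hm
    simpa using (hint k).comp_neg

theorem exists_seminorm_mul_fourierInv_le (G : 𝓢(V, ℂ)) (k n : ℕ) : ∃ C, 0 ≤ C ∧ ∀ ψ : 𝓢(V, ℂ),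
    SchwartzMap.seminorm ℂ k n (SchwartzMap.smulLeftCLM ℂ G (𝓕⁻ ψ)) ≤
      C * ∫ x, (1 + ‖x‖) ^ n * ‖ψ x‖ := by
  refine ⟨∑ i ∈ Finset.range (n + 1), n.choose i * SchwartzMap.seminorm ℂ k i G *
    (2 * Real.pi) ^ (n - i), by positivity, fun ψ => ?_⟩
  have hI : 0 ≤ ∫ x, (1 + ‖x‖) ^ n * ‖ψ x‖ := integral_nonneg fun x => by positivity
  refine SchwartzMap.seminorm_le_bound _ _ _ _ (by positivity) fun ξ => ?_
  have hco : ⇑(SchwartzMap.smulLeftCLM ℂ G (𝓕⁻ ψ)) = fun y => G y * (𝓕⁻ ψ : 𝓢(V, ℂ)) y := by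
    ext y
    simp [SchwartzMap.smulLeftCLM_apply_apply G.hasTemperateGrowth]
  rw [hco]
  have h := norm_iteratedFDeriv_mul_le (𝕜 := ℝ) (N := (⊤ : ℕ∞)) (G.smooth ⊤)
    ((𝓕⁻ ψ : 𝓢(V, ℂ)).smooth ⊤) ξ (n := n) (by exact_mod_cast le_top)
  calc _ ≤ ‖ξ‖ ^ k * ∑ i ∈ Finset.range (n + 1), n.choose i * ‖iteratedFDeriv ℝ i G ξ‖ *
        ‖iteratedFDeriv ℝ (n - i) (𝓕⁻ ψ : 𝓢(V, ℂ)) ξ‖ := by gcongr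
    _ = ∑ i ∈ Finset.range (n + 1), n.choose i * (‖ξ‖ ^ k * ‖iteratedFDeriv ℝ i G ξ‖) *
        ‖iteratedFDeriv ℝ (n - i) (𝓕⁻ ψ : 𝓢(V, ℂ)) ξ‖ := by
      rw [Finset.mul_sum]
      exact Finset.sum_congr rfl fun i _ => by ring
    _ ≤ ∑ i ∈ Finset.range (n + 1), n.choose i * SchwartzMap.seminorm ℂ k i G *
        ((2 * Real.pi) ^ (n - i) * ∫ x, (1 + ‖x‖) ^ n * ‖ψ x‖) := by
      gcongr with i hi
      · exact SchwartzMap.le_seminorm ℂ k i G ξ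
      · exact norm_iteratedFDeriv_fourierInv_le ψ (Nat.sub_le n i) ξ
    _ = _ := by
      rw [Finset.sum_mul]
      exact Finset.sum_congr rfl fun i _ => by ring

/-- `G(D) T` is continuous for a weighted `L^1` norm. As `𝓕 T` is controlled by Schwartz seminorms
of `G 𝓕⁻ ψ`, the decay of `G` takes care of the weights in frequency, and the derivatives of `𝓕⁻ ψ`
are bounded by moments of `ψ`. -/
theorem exists_norm_fourierMultiplier_le (G : 𝓢(V, ℂ)) (T : 𝓢'(V, ℂ)) :
    ∃ (C : ℝ) (N : ℕ), 0 ≤ C ∧ ∀ ψ : 𝓢(V, ℂ),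
      ‖TemperedDistribution.fourierMultiplierCLM ℂ G T ψ‖ ≤ C * ∫ x, (1 + ‖x‖) ^ N * ‖ψ x‖ := by
  obtain ⟨s, C, hC, h⟩ := exists_norm_le_sup_seminorm (𝓕 T)
  choose c hc0 hc using exists_seminorm_mul_fourierInv_le G
  refine ⟨C * ∑ m ∈ s, c m.1 m.2, ∑ m ∈ s, m.2,
    mul_nonneg hC (Finset.sum_nonneg fun m _ => hc0 _ _), fun ψ => ?_⟩
  set I := ∫ x, (1 + ‖x‖) ^ (∑ m ∈ s, m.2) * ‖ψ x‖ with hI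
  have hI0 : 0 ≤ I := integral_nonneg fun x => by positivity
  refine (h (SchwartzMap.smulLeftCLM ℂ G (𝓕⁻ ψ))).trans ?_
  rw [mul_assoc]
  gcongr
  refine Seminorm.finset_sup_apply_le
    (mul_nonneg (Finset.sum_nonneg fun m _ => hc0 _ _) hI0) fun m hm => ?_
  refine (hc m.1 m.2 ψ).trans ?_
  gcongr
  · exact Finset.sum_nonneg fun m _ => hc0 _ _
  · exact Finset.single_le_sum (f := fun m : ℕ × ℕ => c m.1 m.2) (fun m _ => hc0 _ _) hm
  · refine integral_mono (integrable_one_add_norm_pow_mul_norm ψ _)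
      (integrable_one_add_norm_pow_mul_norm ψ _) fun x => ?_
    dsimp only
    gcongr
    · simp
    · exact Finset.single_le_sum (f := fun m : ℕ × ℕ => m.2) (fun m _ => Nat.zero_le _) hm

theorem exists_memLp_two_weight : ∃ k : ℕ,
    MemLp (fun x : V => (((1 + ‖x‖) ^ k)⁻¹ : ℝ)) 2 volume := by
  obtain ⟨k, hk⟩ := Measure.HasTemperateGrowth.exists_eLpNorm_lt_top 2
    (μ := (volume : Measure V)) inferInstance
  refine ⟨k, ?_, ?_⟩
  · refine Continuous.aestronglyMeasurable (Continuous.inv₀ (by fun_prop) fun x => ?_)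
    exact (one_add_norm_pow_pos x k).ne'
  · convert hk using 3 with x
    rw [Real.rpow_neg (by positivity), Real.rpow_natCast]

theorem TemperedFun.of_memLp_two {f : V → ℂ} (hf : MemLp f 2 volume) : TemperedFun f := by
  obtain ⟨k, hk⟩ := exists_memLp_two_weight (V := V)
  refine ⟨k, ?_⟩
  have := hk.ofReal (K := ℂ)
  refine (this.integrable_mul hf).congr (.of_forall fun x => ?_)
  simp

theorem norm_toLp_two_le (θ : 𝓢(V, ℂ)) {ρ : V → ℝ} (hρ : MemLp ρ 2 volume) :
    ∫ x, ‖ρ x‖ * ‖θ x‖ ≤ (∫ x, ‖ρ x‖ ^ (2 : ℝ)) ^ (1 / 2 : ℝ) * ‖θ.toLp 2 volume‖ := by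
  have h2 : ENNReal.ofReal 2 = 2 := by simp
  have h := integral_mul_norm_le_Lp_mul_Lq (μ := volume) (f := ρ) (g := fun x => ‖θ x‖)
    Real.HolderConjugate.two_two (by rwa [h2]) (by rw [h2]; exact (θ.memLp 2 volume).norm)
  simp only [norm_norm] at h
  refine h.trans (le_of_eq ?_)
  rw [SchwartzMap.norm_toLp' (by simp) (by simp)]
  simp

/-- The Riesz representation theorem in `L^2`, for functionals given on Schwartz functions. -/
theorem exists_memLp_two_of_norm_le (L : 𝓢(V, ℂ) →ₗ[ℂ] ℂ) {C : ℝ}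
    (hL : ∀ θ, ‖L θ‖ ≤ C * ‖θ.toLp 2 volume‖) :
    ∃ u : V → ℂ, MemLp u 2 volume ∧ ∀ θ, L θ = ∫ x, θ x * u x := by
  set ℓ : Lp ℂ 2 (volume : Measure V) →L[ℂ] ℂ :=
    L.extendOfNorm (SchwartzMap.toLpCLM ℂ ℂ 2 (volume : Measure V)).toLinearMap with hℓ
  have hext : ∀ θ : 𝓢(V, ℂ), ℓ (θ.toLp 2 volume) = L θ := fun θ =>
    LinearMap.extendOfNorm_eq
      (e := (SchwartzMap.toLpCLM ℂ ℂ 2 (volume : Measure V)).toLinearMap)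
      (SchwartzMap.denseRange_toLpCLM (F := ℂ) (p := 2) (by simp)) ⟨C, hL⟩ θ
  set u := (InnerProductSpace.toDual ℂ _).symm ℓ with hu
  refine ⟨fun x => (starRingEnd ℂ) (u x), (Lp.memLp u).star, fun θ => ?_⟩
  rw [← hext, ← InnerProductSpace.toDual_symm_apply (y := ℓ), ← hu, L2.inner_def]
  refine integral_congr_ae ?_
  filter_upwards [θ.coeFn_toLp 2 volume] with x hx
  rw [hx]
  simp

/-- The weight `(1 + ‖x‖²)^r`. It is used in place of powers of `1 + ‖x‖` because it is smooth, so
that Schwartz functions can be multiplied by it. -/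
noncomputable def japaneseWeight (r : ℝ) (x : V) : ℂ := (((1 + ‖x‖ ^ 2) ^ r : ℝ) : ℂ)

theorem hasTemperateGrowth_japaneseWeight (r : ℝ) :
    (japaneseWeight r : V → ℂ).HasTemperateGrowth := by
  unfold japaneseWeight
  fun_prop

theorem japaneseWeight_neg_mul (r : ℝ) (x : V) :
    japaneseWeight (-r) x * japaneseWeight r x = 1 := by
  simp only [japaneseWeight]
  rw [← Complex.ofReal_mul, ← Real.rpow_add (by positivity)]
  simp

theorem one_add_norm_pow_mul_japaneseWeight_le (N k : ℕ) (x : V) :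
    (1 + ‖x‖) ^ N * ‖japaneseWeight (-((N + k : ℕ) : ℝ)) x‖ ≤
      2 ^ (N + k) * ((1 + ‖x‖) ^ k)⁻¹ := by
  have hx : (0 : ℝ) < 1 + ‖x‖ := by positivity
  simp only [japaneseWeight, Complex.norm_real]
  rw [Real.norm_of_nonneg (by positivity), Real.rpow_neg (by positivity), Real.rpow_natCast,
    ← div_eq_mul_inv, ← div_eq_mul_inv, div_le_div_iff₀ (by positivity) (by positivity),
    ← pow_add, ← mul_pow]
  have h1 : 1 + ‖x‖ ≤ 2 * (1 + ‖x‖ ^ 2) := by nlinarith [sq_nonneg (1 - ‖x‖), sq_nonneg ‖x‖]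
  gcongr

theorem TemperedFun.japaneseWeight_mul {f : V → ℂ} (hf : TemperedFun f) (M : ℕ) :
    TemperedFun (fun x => japaneseWeight M x * f x) := by
  have h : TemperedFun (fun x => ((1 + ‖x‖ : ℂ) ^ (2 * M) * f x) *
      (japaneseWeight M x / (1 + ‖x‖ : ℂ) ^ (2 * M))) := by
    have h0 : ∀ x : V, (1 + ‖x‖ : ℂ) ≠ 0 := fun x => by
      have : (0 : ℝ) < 1 + ‖x‖ := by positivity
      exact_mod_cast this.ne'
    refine (hf.pow_mul (2 * M)).mul_bounded (B := 1) ?_ (.of_forall fun x => ?_)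
    · refine Continuous.aestronglyMeasurable (Continuous.div ?_ (by fun_prop) fun x => ?_)
      · exact (hasTemperateGrowth_japaneseWeight _).1.continuous
      · exact pow_ne_zero _ (h0 x)
    · have : (1 + ‖x‖ : ℂ) = ((1 + ‖x‖ : ℝ) : ℂ) := by push_cast; rfl
      rw [this, japaneseWeight, ← Complex.ofReal_pow, ← Complex.ofReal_div, Complex.norm_real,
        Real.norm_of_nonneg (by positivity), div_le_one (by positivity), Real.rpow_natCast,
        _root_.pow_mul]
      gcongr
      nlinarith [norm_nonneg x]
  refine h.congr (.of_forall fun x => ?_)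
  have : (1 + ‖x‖ : ℂ) ^ (2 * M) ≠ 0 := by
    have : (0 : ℝ) < 1 + ‖x‖ := by positivity
    exact pow_ne_zero _ (by exact_mod_cast this.ne')
  field_simp

/-- A distribution which is continuous for a weighted `L^1` norm is a function: it is bounded on
a weighted `L^2` space, so that the Riesz representation theorem applies. -/
theorem exists_represents_of_norm_le {S : 𝓢'(V, ℂ)} {C : ℝ} {N : ℕ} (hC : 0 ≤ C)
    (h : ∀ ψ : 𝓢(V, ℂ), ‖S ψ‖ ≤ C * ∫ x, (1 + ‖x‖) ^ N * ‖ψ x‖) : ∃ f, Represents f S := by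
  obtain ⟨k, hk⟩ := exists_memLp_two_weight (V := V)
  obtain ⟨M, hM⟩ : ∃ M, M = N + k := ⟨_, rfl⟩
  have hWt := hasTemperateGrowth_japaneseWeight (V := V)
  let L : 𝓢(V, ℂ) →ₗ[ℂ] ℂ :=
    { toFun := fun θ => S (SchwartzMap.smulLeftCLM ℂ (japaneseWeight (-(M : ℝ))) θ)
      map_add' := fun a b => by rw [map_add, map_add]
      map_smul' := fun a b => by rw [map_smul, map_smul]; rfl }
  have hL : ∀ θ, ‖L θ‖ ≤ (C * (2 ^ M * (∫ x : V, ‖((1 + ‖x‖) ^ k)⁻¹‖ ^ (2 : ℝ)) ^ (1 / 2 : ℝ))) *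
      ‖θ.toLp 2 volume‖ := fun θ => by
    refine (h _).trans ?_
    rw [mul_assoc, mul_assoc]
    gcongr
    have hi : Integrable fun x => ‖(((1 + ‖x‖) ^ k)⁻¹ : ℝ)‖ * ‖θ x‖ := by
      have := hk.norm.integrable_mul (θ.memLp 2 volume).norm
      exact this
    refine le_trans ?_ (mul_le_mul_of_nonneg_left (norm_toLp_two_le θ hk) (by positivity))
    rw [← integral_const_mul]
    refine integral_mono (integrable_one_add_norm_pow_mul_norm _ _) (hi.const_mul _) fun x => ?_
    have := one_add_norm_pow_mul_japaneseWeight_le N k x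
    rw [← hM] at this
    simp only [SchwartzMap.smulLeftCLM_apply_apply (hWt _), norm_smul, ← mul_assoc]
    rw [Real.norm_of_nonneg (show 0 ≤ ((1 + ‖x‖) ^ k)⁻¹ by positivity)]
    gcongr
  obtain ⟨u, hu, hrep⟩ := exists_memLp_two_of_norm_le L hL
  refine ⟨fun x => japaneseWeight M x * u x,
    (TemperedFun.of_memLp_two hu).japaneseWeight_mul M, fun ψ => ?_⟩
  have h1 : S ψ = L (SchwartzMap.smulLeftCLM ℂ (japaneseWeight M) ψ) := by
    change _ = S _
    congr 1
    ext x
    rw [SchwartzMap.smulLeftCLM_apply_apply (hWt _), SchwartzMap.smulLeftCLM_apply_apply (hWt _),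
      smul_smul, japaneseWeight_neg_mul, one_smul]
  rw [h1, hrep]
  refine integral_congr_ae (.of_forall fun x => ?_)
  simp only [SchwartzMap.smulLeftCLM_apply_apply (hWt _), smul_eq_mul]
  ring

/-- A multiplier with Schwartz symbol maps every tempered distribution to a function. This is what
makes the low frequencies of the velocity a function, about which nothing else is known. -/
theorem exists_represents_fourierMultiplier (G : 𝓢(V, ℂ)) (T : 𝓢'(V, ℂ)) :
    ∃ f, Represents f (TemperedDistribution.fourierMultiplierCLM ℂ G T) := by
  obtain ⟨C, N, hC, h⟩ := exists_norm_fourierMultiplier_le G T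
  exact exists_represents_of_norm_le hC h

/-! ### Smoothness of convolutions -/

section Smooth

variable {F : Type} [NormedAddCommGroup F] [NormedSpace ℝ F] [NormedSpace ℂ F]

theorem norm_smul_schwartz_sub_le {f : V → ℂ} {k : 𝓢(V, F)} {M : ℕ} {C R : ℝ}
    (hC : ∀ x, (1 + ‖x‖) ^ M * ‖k x‖ ≤ C) {x : V} (hx : ‖x‖ ≤ R) (y : V) :
    ‖f y • k (x - y)‖ ≤ C * (1 + R) ^ M * ‖((1 + ‖y‖) ^ M)⁻¹ • f y‖ := by
  have h1 := one_add_norm_pow_le_mul x y M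
  have hy := one_add_norm_pow_pos y M
  have hC0 : 0 ≤ C := le_trans (by positivity) (hC 0)
  rw [norm_smul, norm_smul, Real.norm_of_nonneg (by positivity)]
  calc ‖f y‖ * ‖k (x - y)‖ = (1 + ‖y‖) ^ M * ‖k (x - y)‖ * (((1 + ‖y‖) ^ M)⁻¹ * ‖f y‖) := by
        field_simp
    _ ≤ ((1 + ‖x - y‖) ^ M * (1 + ‖x‖) ^ M) * ‖k (x - y)‖ * (((1 + ‖y‖) ^ M)⁻¹ * ‖f y‖) := by
        gcongr
    _ = ((1 + ‖x - y‖) ^ M * ‖k (x - y)‖) * (1 + ‖x‖) ^ M * (((1 + ‖y‖) ^ M)⁻¹ * ‖f y‖) := by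
        ring
    _ ≤ C * (1 + R) ^ M * (((1 + ‖y‖) ^ M)⁻¹ * ‖f y‖) := by
        gcongr
        exact hC _

theorem TemperedFun.integrable_smul_schwartz {f : V → ℂ} (hf : TemperedFun f) (k : 𝓢(V, F))
    (x : V) : Integrable (fun y => f y • k (x - y)) := by
  have hfm := hf.aestronglyMeasurable
  obtain ⟨M, hM⟩ := hf
  obtain ⟨C, hC0, hC⟩ := exists_one_add_norm_pow_mul_le k M
  refine (hM.norm.const_mul (C * (1 + ‖x‖) ^ M)).mono' (hfm.smul ?_)
    (.of_forall fun y => norm_smul_schwartz_sub_le hC le_rfl y)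
  exact (k.continuous.comp (by fun_prop)).aestronglyMeasurable

theorem TemperedFun.hasFDerivAt_integral_smul_schwartz {f : V → ℂ} (hf : TemperedFun f)
    (k : 𝓢(V, F)) (x : V) :
    HasFDerivAt (fun x => ∫ y, f y • k (x - y))
      (∫ y, f y • SchwartzMap.fderivCLM ℝ V F k (x - y)) x := by
  have hf' := hf
  obtain ⟨M, hM⟩ := hf'
  obtain ⟨C, hC0, hC⟩ := exists_one_add_norm_pow_mul_le (SchwartzMap.fderivCLM ℝ V F k) M
  refine hasFDerivAt_integral_of_dominated_of_fderiv_le (s := Metric.ball x 1)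
    (F' := fun x y => f y • SchwartzMap.fderivCLM ℝ V F k (x - y))
    (bound := fun y => C * (1 + (‖x‖ + 1)) ^ M * ‖((1 + ‖y‖) ^ M)⁻¹ • f y‖)
    (Metric.ball_mem_nhds x one_pos)
    (.of_forall fun z => (hf.integrable_smul_schwartz k z).1) (hf.integrable_smul_schwartz k x)
    (hf.integrable_smul_schwartz (SchwartzMap.fderivCLM ℝ V F k) x).1
    (.of_forall fun y z hz => norm_smul_schwartz_sub_le hC ?_ y) (hM.norm.const_mul _)
    (.of_forall fun y z _ => ?_)
  · have h1 : ‖z - x‖ < 1 := by simpa [dist_eq_norm] using hz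
    calc ‖z‖ = ‖x + (z - x)‖ := by simp
      _ ≤ ‖x‖ + ‖z - x‖ := norm_add_le _ _
      _ ≤ _ := by linarith
  · have h1 := (k.hasFDerivAt (z - y)).comp z ((hasFDerivAt_id z).sub_const y)
    exact h1.const_smul (f y)

/-- The codomain `F` varies in the induction: the derivative of such an integral is one of the same
kind, with a kernel which has values in `V →L[ℝ] F`. -/
theorem TemperedFun.contDiff_integral_smul_schwartz {f : V → ℂ} (hf : TemperedFun f) (n : ℕ) :
    ∀ (F : Type) [NormedAddCommGroup F] [NormedSpace ℝ F] [NormedSpace ℂ F] (k : 𝓢(V, F)),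
      ContDiff ℝ n (fun x => ∫ y, f y • k (x - y)) := by
  induction n with
  | zero =>
    intro F _ _ _ k
    exact contDiff_zero.2 <| continuous_iff_continuousAt.2 fun x =>
      (hf.hasFDerivAt_integral_smul_schwartz k x).continuousAt
  | succ n ih =>
    intro F _ _ _ k
    refine (contDiff_succ_iff_fderiv (n := (n : WithTop ℕ∞))).2
      ⟨fun x => (hf.hasFDerivAt_integral_smul_schwartz k x).differentiableAt, by simp, ?_⟩
    have : fderiv ℝ (fun x => ∫ y, f y • k (x - y)) =
        fun x => ∫ y, f y • SchwartzMap.fderivCLM ℝ V F k (x - y) :=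
      funext fun x => (hf.hasFDerivAt_integral_smul_schwartz k x).fderiv
    rw [this]
    exact ih _ _

end Smooth

theorem conv_eq_integral_smul (k f : V → ℂ) : conv k f = fun x => ∫ y, f y • k (x - y) := by
  ext x
  exact integral_congr_ae (.of_forall fun y => mul_comm _ _)

theorem TemperedFun.contDiff_conv {f : V → ℂ} (hf : TemperedFun f) (k : 𝓢(V, ℂ)) :
    ContDiff ℝ ((⊤ : ℕ∞) : WithTop ℕ∞) (conv k f) := by
  rw [conv_eq_integral_smul]
  exact contDiff_infty.2 fun n => hf.contDiff_integral_smul_schwartz n ℂ k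

theorem TemperedFun.fderiv_conv {f : V → ℂ} (hf : TemperedFun f) (k : 𝓢(V, ℂ)) (x m : V) :
    fderiv ℝ (conv k f) x m = conv (∂_{m} k : 𝓢(V, ℂ)) f x := by
  rw [conv_eq_integral_smul, conv_eq_integral_smul,
    (hf.hasFDerivAt_integral_smul_schwartz k x).fderiv,
    ContinuousLinearMap.integral_apply (hf.integrable_smul_schwartz _ x)]
  rfl

/-- The reflected translate `y ↦ k (x - y)`. -/
noncomputable def reflect (k : 𝓢(V, ℂ)) (x : V) : 𝓢(V, ℂ) :=
  SchwartzMap.compSubConstCLM ℂ x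
    (SchwartzMap.compCLMOfContinuousLinearEquiv ℂ (ContinuousLinearEquiv.neg ℝ) k)

theorem reflect_apply (k : 𝓢(V, ℂ)) (x y : V) : reflect k x y = k (x - y) := by
  simp [reflect]

theorem lineDerivOp_reflect (k : 𝓢(V, ℂ)) (x m : V) :
    ∂_{m} (reflect k x) = - reflect (∂_{m} k) x := by
  ext y
  rw [SchwartzMap.lineDerivOp_apply_eq_fderiv, neg_apply, reflect_apply,
    SchwartzMap.lineDerivOp_apply_eq_fderiv]
  have : ⇑(reflect k x) = fun y => k (x - y) := funext fun y => reflect_apply k x y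
  rw [this]
  have h1 := (k.hasFDerivAt (x - y)).comp y ((hasFDerivAt_id y).const_sub x)
  have h2 : fderiv ℝ (fun y => k (x - y)) y = _ := h1.fderiv
  rw [h2]
  simp

theorem Represents.apply_reflect {f : V → ℂ} {T : 𝓢'(V, ℂ)} (hf : Represents f T) (k : 𝓢(V, ℂ))
    (x : V) : T (reflect k x) = conv k f x := by
  rw [hf.2]
  simp only [reflect_apply, conv]

/-- A derivative can be moved from one factor of a convolution to the other. -/
theorem Represents.conv_lineDeriv {f g : V → ℂ} {T : 𝓢'(V, ℂ)} {m : V} (hf : Represents f T)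
    (hg : Represents g (∂_{m} T)) (k : 𝓢(V, ℂ)) (x : V) :
    conv (∂_{m} k : 𝓢(V, ℂ)) f x = conv k g x := by
  rw [← hf.apply_reflect, ← hg.apply_reflect, TemperedDistribution.lineDerivOp_apply_apply,
    lineDerivOp_reflect, neg_neg]

end

/-! ### Distributions with bounded gradient -/

theorem norm_clm_le_of_basis (L : E d →L[ℝ] ℂ) {M : ℝ} (hM : 0 ≤ M) (h : ∀ i, ‖L (e i)‖ ≤ M) :
    ‖L‖ ≤ d * M := by
  refine L.opNorm_le_bound (by positivity) fun x => ?_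
  have hx : x = ∑ i, x i • (e i : E d) := by
    have := (EuclideanSpace.basisFun (Fin d) ℝ).sum_repr x
    simpa [e] using this.symm
  calc ‖L x‖ = ‖∑ i, x i • L (e i)‖ := by
        conv_lhs => rw [hx]
        simp
    _ ≤ ∑ i, ‖x i • L (e i)‖ := norm_sum_le _ _
    _ ≤ ∑ _i : Fin d, ‖x‖ * M := by
        refine Finset.sum_le_sum fun i _ => ?_
        rw [norm_smul]
        gcongr
        · exact PiLp.norm_apply_le x i
        · exact h i
    _ = _ := by simp; ring

/-- A function whose distributional gradient is bounded is Lipschitz outside a null set. It is the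
limit almost everywhere of its mollifications, which are uniformly Lipschitz. -/
theorem Represents.exists_lipschitz {f : E d → ℂ} {T : 𝓢'(E d, ℂ)} (hf : Represents f T) {M : ℝ}
    (hM : 0 ≤ M) (h : ∀ i, BoundedBy (∂_{(e i : E d)} T) M) :
    ∃ s : Set (E d), (∀ᵐ x, x ∈ s) ∧ ∀ x ∈ s, ∀ y ∈ s, ‖f x - f y‖ ≤ d * M * ‖x - y‖ := by
  let φ : ℕ → ContDiffBump (0 : E d) := fun n => ⟨1 / (n + 1), 2 / (n + 1), by positivity, by
    gcongr; norm_num⟩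
  have hφ : Filter.Tendsto (fun n => (φ n).rOut) Filter.atTop (nhds 0) := by
    have := (tendsto_one_div_add_atTop_nhds_zero_nat (𝕜 := ℝ)).const_mul 2
    simpa [φ, div_eq_mul_inv] using this
  have hK : ∀ᶠ n in Filter.atTop, (φ n).rOut ≤ 2 * (φ n).rIn :=
    .of_forall fun n => by simp [φ, div_eq_mul_inv]
  have hae := ContDiffBump.ae_convolution_tendsto_right_of_locallyIntegrable (μ := volume)
    hφ hK hf.1.locallyIntegrable
  have hc : ∀ n, HasCompactSupport (Complex.ofRealCLM ∘ (φ n).normed volume) :=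
    fun n => (φ n).hasCompactSupport_normed.comp_left rfl
  have hs : ∀ n, ContDiff ℝ ((⊤ : ℕ∞) : WithTop ℕ∞) (Complex.ofRealCLM ∘ (φ n).normed volume) :=
    fun n => Complex.ofRealCLM.contDiff.comp (φ n).contDiff_normed
  let k : ℕ → 𝓢(E d, ℂ) := fun n => (hc n).toSchwartzMap (hs n)
  have hk1 : ∀ n, ∫ y, ‖k n y‖ = 1 := fun n => by
    rw [← (φ n).integral_normed (μ := volume)]
    refine integral_congr_ae (.of_forall fun y => ?_)
    simp [k, abs_of_nonneg ((φ n).nonneg_normed y)]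
  have hconv : ∀ n x, convolution ((φ n).normed volume) f (ContinuousLinearMap.lsmul ℝ ℝ) volume x
      = conv (k n) f x := fun n x => by
    rw [convolution_lsmul_swap]
    rfl
  have hlip : ∀ n x y, ‖conv (k n) f x - conv (k n) f y‖ ≤ d * M * ‖x - y‖ := fun n x y => by
    refine Convex.norm_image_sub_le_of_norm_fderiv_le (𝕜 := ℝ) (s := Set.univ) (fun z _ => ?_)
      (fun z _ => ?_) convex_univ (Set.mem_univ y) (Set.mem_univ x)
    · exact ((hf.1.contDiff_conv (k n)).differentiable (by simp)).differentiableAt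
    · refine norm_clm_le_of_basis _ hM fun i => ?_
      obtain ⟨g, hg, hgM⟩ := h i
      rw [hf.1.fderiv_conv, hf.conv_lineDeriv hg]
      refine (norm_conv_le hgM z).trans ?_
      rw [hk1, one_mul]
  simp only [hconv] at hae
  refine ⟨{x | Filter.Tendsto (fun n => conv (k n) f x) Filter.atTop (nhds (f x))}, hae,
    fun x hx y hy => ?_⟩
  exact le_of_tendsto (Filter.Tendsto.norm (Filter.Tendsto.sub hx hy))
    (.of_forall fun n => hlip n x y)

section

variable {V : Type} [NormedAddCommGroup V] [InnerProductSpace ℝ V] [FiniteDimensional ℝ V]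
  [MeasurableSpace V] [BorelSpace V]

open FourierTransform

/-! ### Operations on symbols -/

/-- The dilated symbol `ξ ↦ G (c⁻¹ ξ)` (and `G` itself for `c = 0`). -/
noncomputable def dilate (c : ℝ) (G : 𝓢(V, ℂ)) : 𝓢(V, ℂ) :=
  if hc : c = 0 then G else SchwartzMap.compCLMOfContinuousLinearEquiv ℂ
    (ContinuousLinearEquiv.smulLeft (Units.mk0 c⁻¹ (inv_ne_zero hc))) G

theorem dilate_apply {c : ℝ} (hc : c ≠ 0) (G : 𝓢(V, ℂ)) (ξ : V) :
    dilate c G ξ = G (c⁻¹ • ξ) := by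
  simp [dilate, hc, Units.smul_def]

/-- The symbol `2πi ⟨ξ, m⟩ G(ξ)` of the composition of `G(D)` and `∂_m`. -/
noncomputable def derivSymbol (m : V) (G : 𝓢(V, ℂ)) : 𝓢(V, ℂ) :=
  (2 * Real.pi * Complex.I) • SchwartzMap.smulLeftCLM ℂ (fun ξ => inner ℝ ξ m) G

theorem derivSymbol_apply (m : V) (G : 𝓢(V, ℂ)) (ξ : V) :
    derivSymbol m G ξ = 2 * Real.pi * Complex.I * inner ℝ ξ m * G ξ := by
  rw [derivSymbol, smul_apply, SchwartzMap.smulLeftCLM_apply_apply (by fun_prop)]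
  simp [mul_assoc]

theorem derivSymbol_dilate {c : ℝ} (hc : c ≠ 0) (m : V) (G : 𝓢(V, ℂ)) :
    derivSymbol m (dilate c G) = (c : ℂ) • dilate c (derivSymbol m G) := by
  ext ξ
  have hc' : (c : ℂ) ≠ 0 := by exact_mod_cast hc
  rw [smul_apply, derivSymbol_apply, dilate_apply hc, dilate_apply hc, derivSymbol_apply,
    inner_smul_left]
  simp
  field_simp

theorem derivSymbol_smul (a : ℂ) (m : V) (G : 𝓢(V, ℂ)) :
    derivSymbol m (a • G) = a • derivSymbol m G := by
  ext ξ
  rw [smul_apply, derivSymbol_apply, derivSymbol_apply, smul_apply]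
  simp only [smul_eq_mul]
  ring

theorem derivSymbol_comm (m l : V) (G : 𝓢(V, ℂ)) :
    derivSymbol m (derivSymbol l G) = derivSymbol l (derivSymbol m G) := by
  ext ξ
  simp only [derivSymbol_apply]
  ring

theorem lineDerivOp_fourierInv (m : V) (G : 𝓢(V, ℂ)) :
    (∂_{m} (𝓕⁻ G : 𝓢(V, ℂ)) : 𝓢(V, ℂ)) = 𝓕⁻ (derivSymbol m G) :=
  SchwartzMap.lineDerivOp_fourierInv_eq G m

/-- The moments `∫ |x|^n |k(x)| dx` of the kernel `k` of the multiplier `G(D)`. -/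
noncomputable def moment (n : ℕ) (G : 𝓢(V, ℂ)) : ℝ := ∫ x, ‖x‖ ^ n * ‖(𝓕⁻ G : 𝓢(V, ℂ)) x‖

theorem moment_nonneg (n : ℕ) (G : 𝓢(V, ℂ)) : 0 ≤ moment n G :=
  integral_nonneg fun x => by positivity

theorem moment_smul (n : ℕ) (a : ℂ) (G : 𝓢(V, ℂ)) : moment n (a • G) = ‖a‖ * moment n G := by
  rw [moment, moment, ← integral_const_mul]
  refine integral_congr_ae (.of_forall fun x => ?_)
  simp only [FourierTransform.fourierInv_smul, smul_apply, norm_smul]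
  ring

theorem moment_dilate {c : ℝ} (hc : 0 < c) (n : ℕ) (G : 𝓢(V, ℂ)) :
    moment n (dilate c G) = (c ^ n)⁻¹ * moment n G := by
  simp only [moment, SchwartzMap.fourierInv_coe]
  exact integral_norm_pow_mul_fourierInv_dilation hc (dilate_apply hc.ne' G) n

open TemperedDistribution in
theorem fourierMultiplier_derivSymbol (m : V) (G : 𝓢(V, ℂ)) (T : 𝓢'(V, ℂ)) :
    fourierMultiplierCLM ℂ (derivSymbol m G) T = fourierMultiplierCLM ℂ G (∂_{m} T) := by
  ext ψ
  rw [fourierMultiplierCLM_apply_apply, fourierMultiplierCLM_apply_apply,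
    lineDerivOp_apply_apply, SchwartzMap.lineDerivOp_fourier_eq]
  congr 1
  rw [← FourierTransform.fourier_neg]
  congr 1
  ext ξ
  rw [neg_apply, smul_apply, SchwartzMap.smulLeftCLM_apply_apply (by fun_prop),
    SchwartzMap.smulLeftCLM_apply_apply (by fun_prop),
    SchwartzMap.smulLeftCLM_apply_apply (by fun_prop), derivSymbol_apply]
  simp
  ring

open TemperedDistribution in
theorem lineDerivOp_fourierMultiplier (m : V) (G : 𝓢(V, ℂ)) (T : 𝓢'(V, ℂ)) :
    ∂_{m} (fourierMultiplierCLM ℂ G T) = fourierMultiplierCLM ℂ (derivSymbol m G) T := by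
  ext ψ
  rw [lineDerivOp_apply_apply, fourierMultiplierCLM_apply_apply,
    fourierMultiplierCLM_apply_apply, FourierTransform.fourierInv_neg,
    SchwartzMap.fourierInv_lineDerivOp_eq]
  congr 2
  ext ξ
  rw [SchwartzMap.smulLeftCLM_apply_apply (by fun_prop),
    SchwartzMap.smulLeftCLM_apply_apply (by fun_prop), neg_apply, smul_apply,
    SchwartzMap.smulLeftCLM_apply_apply (by fun_prop), derivSymbol_apply]
  simp
  ring

open TemperedDistribution in
theorem fourierMultiplier_smul (a : ℂ) (G : 𝓢(V, ℂ)) (T : 𝓢'(V, ℂ)) :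
    fourierMultiplierCLM ℂ (a • G : 𝓢(V, ℂ)) T = a • fourierMultiplierCLM ℂ G T := by
  have := fourierMultiplierCLM_smul (F := ℂ) G.hasTemperateGrowth a
  exact congrArg (fun A => A T) this

open TemperedDistribution in
theorem fourierMultiplier_sum {ι : Type*} (s : Finset ι) (G : ι → 𝓢(V, ℂ)) (T : 𝓢'(V, ℂ)) :
    fourierMultiplierCLM ℂ (∑ i ∈ s, G i : 𝓢(V, ℂ)) T =
      ∑ i ∈ s, fourierMultiplierCLM ℂ (G i) T := by
  have := fourierMultiplierCLM_sum ℂ (s := s) fun i _ => (G i).hasTemperateGrowth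
  have h2 : ⇑(∑ i ∈ s, G i) = fun ξ => ∑ i ∈ s, G i ξ := by
    ext ξ
    simp
  rw [h2, this]
  simp

theorem BoundedBy.fourierMultiplier_moment {T : 𝓢'(V, ℂ)} {B : ℝ} (hT : BoundedBy T B)
    (G : 𝓢(V, ℂ)) :
    BoundedBy (TemperedDistribution.fourierMultiplierCLM ℂ G T) (moment 0 G * B) := by
  simpa [moment] using hT.fourierMultiplier G

/-! ### Approximation of the identity by cut-offs in frequency -/

/-- The derivatives of `η(c ·) - 1` are `O(c)`, at the price of one power of `1 + ‖x‖`: where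
`η(c x) ≠ 1`, the norm of `x` is at least `r / c`. -/
theorem exists_norm_iteratedFDeriv_cutoff_le (η : 𝓢(V, ℂ)) {r : ℝ} (hr : 0 < r)
    (h : ∀ x, ‖x‖ < r → η x = 1) (i : ℕ) :
    ∃ B, 0 ≤ B ∧ ∀ c : ℝ, 0 < c → c ≤ 1 → ∀ x,
      ‖iteratedFDeriv ℝ i (fun x => η (c • x) - 1) x‖ ≤ c * (B * (1 + ‖x‖)) := by
  cases i with
  | zero =>
    refine ⟨(SchwartzMap.seminorm ℝ 0 0 η + 1) / r, by positivity, fun c hc _ x => ?_⟩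
    rw [norm_iteratedFDeriv_zero]
    by_cases hx : ‖c • x‖ < r
    · rw [h _ hx]
      simp
      positivity
    · rw [norm_smul, Real.norm_of_nonneg hc.le, not_lt] at hx
      have h1 : ‖η (c • x) - 1‖ ≤ SchwartzMap.seminorm ℝ 0 0 η + 1 := by
        refine (norm_sub_le _ _).trans ?_
        gcongr
        · exact SchwartzMap.norm_le_seminorm ℝ η _
        · simp
      have h2 : 1 ≤ c * (1 + ‖x‖) / r := by
        rw [le_div_iff₀ hr]
        nlinarith
      calc _ ≤ (SchwartzMap.seminorm ℝ 0 0 η + 1) * 1 := by rwa [mul_one]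
        _ ≤ (SchwartzMap.seminorm ℝ 0 0 η + 1) * (c * (1 + ‖x‖) / r) := by gcongr
        _ = _ := by ring
  | succ i =>
    refine ⟨SchwartzMap.seminorm ℝ 0 (i + 1) η, by positivity, fun c hc hc1 x => ?_⟩
    have hη : ContDiff ℝ (i + 1 : ℕ) η := η.smooth (i + 1 : ℕ)
    have h1 : iteratedFDeriv ℝ (i + 1) (fun x => η (c • x) - 1) x =
        c ^ (i + 1) • iteratedFDeriv ℝ (i + 1) η (c • x) := by
      rw [fun_iteratedFDeriv_sub_apply (by fun_prop) (by fun_prop), iteratedFDeriv_succ_const,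
        iteratedFDeriv_comp_const_smul c hη]
      simp
    rw [h1, norm_smul, norm_pow, Real.norm_of_nonneg hc.le]
    have h2 : c ^ (i + 1) ≤ c := by
      rw [pow_succ]
      exact mul_le_of_le_one_left hc.le (pow_le_one₀ hc.le hc1)
    have h3 := SchwartzMap.norm_iteratedFDeriv_le_seminorm ℝ η (i + 1) (c • x)
    calc _ ≤ c * (SchwartzMap.seminorm ℝ 0 (i + 1) η * 1) := by
          rw [mul_one]; gcongr
      _ ≤ _ := by
          gcongr
          simp

theorem exists_seminorm_cutoff_sub_le (η : 𝓢(V, ℂ)) {r : ℝ} (hr : 0 < r)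
    (h : ∀ x, ‖x‖ < r → η x = 1) (ψ : 𝓢(V, ℂ)) (k n : ℕ) :
    ∃ C, ∀ c : ℝ, 1 ≤ c →
      SchwartzMap.seminorm ℂ k n (SchwartzMap.smulLeftCLM ℂ (dilate c η) ψ - ψ) ≤ C * c⁻¹ := by
  choose B hB0 hB using exists_norm_iteratedFDeriv_cutoff_le η hr h
  refine ⟨∑ i ∈ Finset.range (n + 1), n.choose i * B i * (SchwartzMap.seminorm ℂ k (n - i) ψ +
    SchwartzMap.seminorm ℂ (k + 1) (n - i) ψ), fun c hc => ?_⟩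
  have hc0 : 0 < c := by linarith
  refine SchwartzMap.seminorm_le_bound _ _ _ _ (mul_nonneg (Finset.sum_nonneg fun i _ =>
    mul_nonneg (mul_nonneg (by positivity) (hB0 i)) (by positivity)) (by positivity)) fun x => ?_
  have hco : ⇑(SchwartzMap.smulLeftCLM ℂ (dilate c η) ψ - ψ) =
      fun x => (η (c⁻¹ • x) - 1) * ψ x := by
    ext x
    rw [sub_apply, SchwartzMap.smulLeftCLM_apply_apply (by fun_prop), dilate_apply hc0.ne']
    simp [sub_mul]
  rw [hco]
  have h1 : ContDiff ℝ ((⊤ : ℕ∞) : WithTop ℕ∞) fun x => η (c⁻¹ • x) - 1 :=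
    ((η.smooth ⊤).comp (contDiff_const_smul _)).sub contDiff_const
  have h2 := norm_iteratedFDeriv_mul_le (𝕜 := ℝ) h1 (ψ.smooth ⊤) x (n := n)
    (by exact_mod_cast le_top)
  calc _ ≤ ‖x‖ ^ k * ∑ i ∈ Finset.range (n + 1), n.choose i *
          ‖iteratedFDeriv ℝ i (fun x => η (c⁻¹ • x) - 1) x‖ * ‖iteratedFDeriv ℝ (n - i) ψ x‖ := by
        gcongr
    _ ≤ ‖x‖ ^ k * ∑ i ∈ Finset.range (n + 1), n.choose i *
          (c⁻¹ * (B i * (1 + ‖x‖))) * ‖iteratedFDeriv ℝ (n - i) ψ x‖ := by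
        gcongr with i hi
        exact hB i c⁻¹ (by positivity) (inv_le_one_of_one_le₀ hc) x
    _ = ∑ i ∈ Finset.range (n + 1), n.choose i * B i *
          (‖x‖ ^ k * ‖iteratedFDeriv ℝ (n - i) ψ x‖ +
            ‖x‖ ^ (k + 1) * ‖iteratedFDeriv ℝ (n - i) ψ x‖) * c⁻¹ := by
        rw [Finset.mul_sum]
        exact Finset.sum_congr rfl fun i _ => by ring
    _ ≤ _ := by
        rw [Finset.sum_mul]
        gcongr with i hi
        · exact mul_nonneg (by positivity) (hB0 i)
        · exact SchwartzMap.le_seminorm ℂ _ _ ψ x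
        · exact SchwartzMap.le_seminorm ℂ _ _ ψ x

/-- If `η = 1` near the origin, the operators `η(2^{-N} D)` converge to the identity. -/
theorem tendsto_fourierMultiplier_dilate (η : 𝓢(V, ℂ)) {r : ℝ} (hr : 0 < r)
    (h : ∀ x, ‖x‖ < r → η x = 1) (T : 𝓢'(V, ℂ)) (ψ : 𝓢(V, ℂ)) :
    Filter.Tendsto
      (fun N : ℕ => TemperedDistribution.fourierMultiplierCLM ℂ (dilate (2 ^ N) η) T ψ)
      Filter.atTop (nhds (T ψ)) := by
  obtain ⟨s, C, hC, hT⟩ := exists_norm_le_sup_seminorm (𝓕 T)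
  choose c hc using exists_seminorm_cutoff_sub_le η hr h (𝓕⁻ ψ)
  rw [tendsto_iff_norm_sub_tendsto_zero]
  have hlim : Filter.Tendsto (fun N : ℕ => C * ((∑ m ∈ s, |c m.1 m.2|) * ((2 : ℝ) ^ N)⁻¹))
      Filter.atTop (nhds 0) := by
    have : Filter.Tendsto (fun N : ℕ => ((2 : ℝ) ^ N)⁻¹) Filter.atTop (nhds 0) := by
      have := tendsto_pow_atTop_nhds_zero_of_lt_one (r := (2 : ℝ)⁻¹) (by norm_num) (by norm_num)
      simpa using this
    simpa using (this.const_mul (∑ m ∈ s, |c m.1 m.2|)).const_mul C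
  refine squeeze_zero (fun _ => norm_nonneg _) (fun N => ?_) hlim
  have heq : TemperedDistribution.fourierMultiplierCLM ℂ (dilate (2 ^ N) η) T ψ - T ψ =
      (𝓕 T) (SchwartzMap.smulLeftCLM ℂ (dilate (2 ^ N) η) (𝓕⁻ ψ) - 𝓕⁻ ψ) := by
    rw [map_sub, TemperedDistribution.fourierMultiplierCLM_apply_apply,
      TemperedDistribution.fourier_apply, TemperedDistribution.fourier_apply,
      FourierTransform.fourier_fourierInv_eq]
  rw [heq]
  refine (hT _).trans ?_
  gcongr
  refine Seminorm.finset_sup_apply_le (by positivity) fun m hm => ?_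
  refine (hc m.1 m.2 (2 ^ N) (one_le_pow₀ (by norm_num))).trans ?_
  gcongr
  exact (le_abs_self _).trans (Finset.single_le_sum (f := fun m : ℕ × ℕ => |c m.1 m.2|)
    (fun _ _ => abs_nonneg _) hm)

end

section

open FourierTransform TemperedDistribution

/-! ### The Littlewood-Paley decomposition -/

namespace DyadicPartition

variable (D : DyadicPartition d)

theorem exists_φ_eq_zero : ∃ r, 0 < r ∧ ∀ ξ : E d, ‖ξ‖ < r → D.φ ξ = 0 := by
  have h : (tsupport D.φ)ᶜ ∈ nhds (0 : E d) :=
    (isClosed_tsupport D.φ).isOpen_compl.mem_nhds D.φ_away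
  obtain ⟨r, hr, h⟩ := Metric.mem_nhds_iff.1 h
  refine ⟨r, hr, fun ξ hξ => image_eq_zero_of_notMem_tsupport (h ?_)⟩
  simpa using hξ

/-- Near the origin all the terms of the partition of unity but `χ` vanish, since `φ` does. -/
theorem exists_χ_eq_one : ∃ r, 0 < r ∧ ∀ ξ : E d, ‖ξ‖ < r → D.χ ξ = 1 := by
  obtain ⟨r, hr, h⟩ := D.exists_φ_eq_zero
  refine ⟨r, hr, fun ξ hξ => ?_⟩
  have h0 : ∀ q : ℕ, D.φ ((2 : ℝ) ^ (-(q : ℤ)) • ξ) = 0 := fun q => by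
    refine h _ (lt_of_le_of_lt ?_ hξ)
    rw [norm_smul, Real.norm_of_nonneg (by positivity), zpow_neg, zpow_natCast]
    exact mul_le_of_le_one_left (norm_nonneg _) (inv_le_one_of_one_le₀ (one_le_pow₀ (by norm_num)))
  have h1 := D.sum_eq_one ξ
  simp only [h0] at h1
  linarith [h1.unique hasSum_zero]

/-- The partition of unity at `ξ / 2` is the one at `ξ` with a shifted index. -/
theorem χ_half (ξ : E d) : D.χ ((2 : ℝ)⁻¹ • ξ) = D.χ ξ + D.φ ξ := by
  have h1 := D.sum_eq_one ξ
  have h2 := D.sum_eq_one ((2 : ℝ)⁻¹ • ξ)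
  have h3 : ∀ q : ℕ, D.φ ((2 : ℝ) ^ (-(q : ℤ)) • (2 : ℝ)⁻¹ • ξ) =
      D.φ ((2 : ℝ) ^ (-((q + 1 : ℕ) : ℤ)) • ξ) := fun q => by
    rw [smul_smul, zpow_neg, zpow_neg, zpow_natCast, zpow_natCast, pow_succ, mul_inv]
  simp only [h3] at h2
  have h4 := (hasSum_nat_add_iff' (f := fun q : ℕ => D.φ ((2 : ℝ) ^ (-(q : ℤ)) • ξ)) 1).2 h1
  have h5 := h2.unique h4
  simp at h5
  linarith

theorem χ_dyadic (N : ℕ) (ξ : E d) : D.χ (((2 : ℝ) ^ N)⁻¹ • ξ) =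
    D.χ ξ + ∑ p ∈ Finset.range N, D.φ (((2 : ℝ) ^ p)⁻¹ • ξ) := by
  induction N with
  | zero => simp
  | succ N ih =>
    rw [Finset.sum_range_succ, ← add_assoc, ← ih, ← χ_half, smul_smul, pow_succ, mul_inv, mul_comm]

theorem hasCompactSupport_comp_two_pi {g : E d → ℝ} (hg : HasCompactSupport g) :
    HasCompactSupport fun ξ => ((g ((2 * Real.pi) • ξ) : ℝ) : ℂ) := by
  have h1 : HasCompactSupport fun ξ => g ((2 * Real.pi) • ξ) :=
    hg.comp_homeomorph (Homeomorph.smulOfNeZero (2 * Real.pi) (by positivity))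
  exact h1.comp_left (g := fun x : ℝ => (x : ℂ)) rfl

theorem contDiff_comp_two_pi {g : E d → ℝ} (hg : ContDiff ℝ ((⊤ : ℕ∞) : WithTop ℕ∞) g) :
    ContDiff ℝ ((⊤ : ℕ∞) : WithTop ℕ∞) fun ξ => ((g ((2 * Real.pi) • ξ) : ℝ) : ℂ) :=
  Complex.ofRealCLM.contDiff.comp (hg.comp (contDiff_const_smul _))

/-- The symbol of `Δ_{-1}` in the frequency variable of Mathlib's Fourier transform. -/
noncomputable def lowSymbol : 𝓢(E d, ℂ) :=
  (hasCompactSupport_comp_two_pi D.χ_compact).toSchwartzMap (contDiff_comp_two_pi D.χ_smooth)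

/-- The symbol of `Δ_0` in the frequency variable of Mathlib's Fourier transform. -/
noncomputable def shellSymbol : 𝓢(E d, ℂ) :=
  (hasCompactSupport_comp_two_pi D.φ_compact).toSchwartzMap (contDiff_comp_two_pi D.φ_smooth)

theorem lowSymbol_apply (ξ : E d) : D.lowSymbol ξ = D.χ ((2 * Real.pi) • ξ) := rfl

theorem shellSymbol_apply (ξ : E d) : D.shellSymbol ξ = D.φ ((2 * Real.pi) • ξ) := rfl

/-- The symbol of the inverse of the Laplacian composed with the block `Δ_0`. It is smooth because
`φ` vanishes near the origin, where `0⁻¹ = 0` is harmless for the same reason. -/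
noncomputable def inverseLaplacianSymbol : 𝓢(E d, ℂ) :=
  HasCompactSupport.toSchwartzMap
    (f := fun ξ => D.shellSymbol ξ * ((-(2 * Real.pi) ^ 2 * ‖ξ‖ ^ 2)⁻¹ : ℝ))
    (hasCompactSupport_comp_two_pi D.φ_compact).mul_right (by
      obtain ⟨r, hr, h⟩ := D.exists_φ_eq_zero
      refine contDiff_iff_contDiffAt.2 fun ξ => ?_
      by_cases hξ : ξ = 0
      · have : (fun ξ => D.shellSymbol ξ * (((-(2 * Real.pi) ^ 2 * ‖ξ‖ ^ 2)⁻¹ : ℝ) : ℂ)) =ᶠ[nhds ξ]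
            fun _ => 0 := by
          rw [hξ]
          have hev : ∀ᶠ η : E d in nhds 0, ‖(2 * Real.pi) • η‖ < r := by
            have : Continuous fun η : E d => ‖(2 * Real.pi) • η‖ := by fun_prop
            exact this.continuousAt.eventually_lt continuousAt_const (by simpa using hr)
          filter_upwards [hev] with η hη
          rw [shellSymbol_apply, h _ hη]
          simp
        exact contDiffAt_const.congr_of_eventuallyEq this
      · refine (D.shellSymbol.smooth ⊤).contDiffAt.mul
          (Complex.ofRealCLM.contDiff.contDiffAt.comp ξ (ContDiffAt.inv ?_ ?_))
        · exact contDiffAt_const.mul (contDiff_norm_sq ℝ).contDiffAt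
        · have := norm_pos_iff.2 hξ
          have hp := Real.pi_pos
          exact mul_ne_zero (neg_ne_zero.2 (by positivity)) (by positivity))

theorem inverseLaplacianSymbol_apply (ξ : E d) :
    D.inverseLaplacianSymbol ξ = D.shellSymbol ξ * ((-(2 * Real.pi) ^ 2 * ‖ξ‖ ^ 2)⁻¹ : ℝ) := rfl

theorem neg_mul_inverseLaplacianSymbol (ξ : E d) :
    ((-(2 * Real.pi) ^ 2 * ‖ξ‖ ^ 2 : ℝ) : ℂ) * D.inverseLaplacianSymbol ξ = D.shellSymbol ξ := by
  obtain ⟨r, hr, h⟩ := D.exists_φ_eq_zero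
  rw [inverseLaplacianSymbol_apply]
  by_cases hξ : ξ = 0
  · rw [shellSymbol_apply, h _ (by simpa [hξ] using hr)]
    simp
  · have h0 : (-(2 * Real.pi) ^ 2 * ‖ξ‖ ^ 2 : ℝ) ≠ 0 := by
      have := norm_pos_iff.2 hξ
      have hp := Real.pi_pos
      exact mul_ne_zero (neg_ne_zero.2 (by positivity)) (by positivity)
    rw [mul_left_comm, ← Complex.ofReal_mul, mul_inv_cancel₀ h0]
    simp

/-- The symbol of `Δ_q` as a Schwartz function, for `q ≥ -1`. -/
noncomputable def blockSymbol (q : ℤ) : 𝓢(E d, ℂ) :=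
  if q = -1 then D.lowSymbol else dilate (2 ^ q.toNat) D.shellSymbol

theorem block_eq {q : ℤ} (hq : -1 ≤ q) (T : 𝓢'(E d, ℂ)) :
    D.block q T = fourierMultiplierCLM ℂ (D.blockSymbol q) T := by
  rw [block]
  congr 2
  ext ξ
  by_cases h : q = -1
  · simp [blockSymbol, symbol, h, lowSymbol_apply]
  · have h0 : 0 ≤ q := by omega
    obtain ⟨p, rfl⟩ := Int.eq_ofNat_of_zero_le h0
    simp only [blockSymbol, symbol, h, h0, if_true, if_false]
    rw [dilate_apply (by positivity), shellSymbol_apply, smul_comm]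
    simp

theorem blockSymbol_neg_one : D.blockSymbol (-1) = D.lowSymbol := by simp [blockSymbol]

theorem blockSymbol_natCast (p : ℕ) : D.blockSymbol p = dilate (2 ^ p) D.shellSymbol := by
  have : (p : ℤ) ≠ -1 := by omega
  simp [blockSymbol, this]

/-- The low frequency cut-off `χ(2^{-N} D) = Δ_{-1} + ∑_{p < N} Δ_p`. -/
theorem dilate_lowSymbol (N : ℕ) : dilate (2 ^ N) D.lowSymbol =
    D.blockSymbol (-1) + ∑ p ∈ Finset.range N, D.blockSymbol p := by
  ext ξ
  rw [add_apply, blockSymbol_neg_one, dilate_apply (by positivity), lowSymbol_apply,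
    lowSymbol_apply, smul_comm, χ_dyadic]
  simp only [blockSymbol_natCast]
  push_cast
  congr 1
  rw [Finset.sum_apply]
  refine Finset.sum_congr rfl fun p _ => ?_
  rw [dilate_apply (by positivity), shellSymbol_apply, smul_comm]

/-- The Littlewood-Paley decomposition `T = Δ_{-1} T + ∑ Δ_p T`. -/
theorem tendsto_sum_block (T : 𝓢'(E d, ℂ)) (ψ : 𝓢(E d, ℂ)) :
    Filter.Tendsto (fun N : ℕ => D.block (-1) T ψ + ∑ p ∈ Finset.range N, D.block p T ψ)
      Filter.atTop (nhds (T ψ)) := by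
  obtain ⟨r, hr, h⟩ := D.exists_χ_eq_one
  have h1 := tendsto_fourierMultiplier_dilate D.lowSymbol (r := r / (2 * Real.pi)) (by positivity)
    (fun ξ hξ => by
      rw [lowSymbol_apply, h]
      · simp
      · rw [norm_smul, Real.norm_of_nonneg (by positivity)]
        rwa [lt_div_iff₀' (by positivity)] at hξ) T ψ
  refine h1.congr fun N => ?_
  have h2 : fourierMultiplierCLM ℂ (dilate (2 ^ N) D.lowSymbol) T =
      D.block (-1) T + ∑ p ∈ Finset.range N, D.block p T := by
    rw [dilate_lowSymbol, D.block_eq le_rfl]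
    have h3 : ∀ p ∈ Finset.range N, D.block p T = fourierMultiplierCLM ℂ (D.blockSymbol p) T :=
      fun p _ => D.block_eq (by omega) T
    rw [Finset.sum_congr rfl h3, ← fourierMultiplier_sum]
    have := fourierMultiplier_sum (Finset.univ : Finset (Fin 2))
      ![D.blockSymbol (-1), ∑ p ∈ Finset.range N, D.blockSymbol p] T
    simpa using this
  rw [h2]
  simp

/-! ### Recovering the velocity from the vorticity -/

theorem sum_derivSymbol_inverseLaplacian (p : ℕ) :
    ∑ i, derivSymbol (e i) (derivSymbol (e i) (dilate (2 ^ p) D.inverseLaplacianSymbol)) =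
      ((2 : ℂ) ^ p) ^ 2 • D.blockSymbol p := by
  ext ξ
  have hc : (2 : ℝ) ^ p ≠ 0 := by positivity
  have hn : ∑ i, (inner ℝ ξ (e i : E d) : ℂ) ^ 2 = ((‖ξ‖ ^ 2 : ℝ) : ℂ) := by
    rw [EuclideanSpace.real_norm_sq_eq]
    push_cast
    refine Finset.sum_congr rfl fun i _ => ?_
    simp [e, EuclideanSpace.inner_single_right]
  rw [sum_apply, smul_apply, blockSymbol_natCast, dilate_apply hc,
    ← neg_mul_inverseLaplacianSymbol]
  simp only [derivSymbol_apply, dilate_apply hc]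
  calc _ = (2 * Real.pi * Complex.I) ^ 2 * (∑ i, (inner ℝ ξ (e i : E d) : ℂ) ^ 2) *
        D.inverseLaplacianSymbol (((2 : ℝ) ^ p)⁻¹ • ξ) := by
        rw [Finset.mul_sum, Finset.sum_mul]
        exact Finset.sum_congr rfl fun i _ => by ring
    _ = _ := by
        rw [hn, norm_smul, norm_inv, Real.norm_of_nonneg (by positivity), mul_pow, mul_pow,
          Complex.I_sq]
        push_cast
        simp only [smul_eq_mul]
        field_simp

/-- The Biot-Savart law, localized in frequency: as `div v = 0`, the Laplacian of `v_j` is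
`∑ i, ∂_i ω_{ij}`, and it can be inverted on the block `Δ_p v_j`. The factor `2^{-2p}` comes from
the dilation of the symbol of the inverse. -/
theorem block_eq_sum_curl {v : Fin d → 𝓢'(E d, ℂ)} (hv : divergence v = 0) (p : ℕ) (j : Fin d) :
    D.block p (v j) = (((2 : ℂ) ^ p) ^ 2)⁻¹ • ∑ i, fourierMultiplierCLM ℂ
      (derivSymbol (e i) (dilate (2 ^ p) D.inverseLaplacianSymbol)) (curl v i j) := by
  set Z := dilate (2 ^ p) D.inverseLaplacianSymbol with hZ
  have h1 : ∑ i, fourierMultiplierCLM ℂ (derivSymbol (e i) Z) (∂_{(e i : E d)} (v j)) =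
      ((2 : ℂ) ^ p) ^ 2 • D.block p (v j) := by
    rw [D.block_eq (by omega), ← fourierMultiplier_smul, ← sum_derivSymbol_inverseLaplacian,
      fourierMultiplier_sum]
    exact Finset.sum_congr rfl fun i _ => (fourierMultiplier_derivSymbol _ _ _).symm
  have h2 : ∑ i, fourierMultiplierCLM ℂ (derivSymbol (e i) Z) (∂_{(e j : E d)} (v i)) = 0 := by
    have : ∀ i, fourierMultiplierCLM ℂ (derivSymbol (e i) Z) (∂_{(e j : E d)} (v i)) =
        fourierMultiplierCLM ℂ (derivSymbol (e j) Z) (∂_{(e i : E d)} (v i)) := fun i => by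
      rw [← fourierMultiplier_derivSymbol, derivSymbol_comm, fourierMultiplier_derivSymbol]
    simp_rw [this]
    rw [← map_sum]
    rw [divergence] at hv
    rw [hv, map_zero]
  have h3 : ∑ i, fourierMultiplierCLM ℂ (derivSymbol (e i) Z) (curl v i j) =
      ((2 : ℂ) ^ p) ^ 2 • D.block p (v j) := by
    simp only [curl, map_sub, Finset.sum_sub_distrib, h1, h2, sub_zero]
  rw [h3, inv_smul_smul₀ (pow_ne_zero _ (pow_ne_zero _ two_ne_zero))]

/-- The constant in the estimates of the blocks of the velocity by the vorticity. -/
noncomputable def ellipticConst : ℝ :=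
  ∑ i, moment 0 (derivSymbol (e i) D.inverseLaplacianSymbol) +
    ∑ l, ∑ i, moment 0 (derivSymbol (e l) (derivSymbol (e i) D.inverseLaplacianSymbol))

theorem ellipticConst_nonneg : 0 ≤ D.ellipticConst :=
  add_nonneg (Finset.sum_nonneg fun _ _ => moment_nonneg _ _)
    (Finset.sum_nonneg fun _ _ => Finset.sum_nonneg fun _ _ => moment_nonneg _ _)

/-- `‖Δ_p v‖ ≤ C 2^{-p} ‖ω‖` in `L^∞`. -/
theorem boundedBy_block {v : Fin d → 𝓢'(E d, ℂ)} (hv : divergence v = 0) {W : ℝ} (hW : 0 ≤ W)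
    (hω : ∀ i j, BoundedBy (curl v i j) W) (p : ℕ) (j : Fin d) :
    BoundedBy (D.block p (v j)) (D.ellipticConst * W * (2⁻¹) ^ p) := by
  rw [D.block_eq_sum_curl hv]
  have hc : (2 : ℝ) ^ p ≠ 0 := by positivity
  have h := BoundedBy.smul (BoundedBy.finset_sum (s := Finset.univ) fun i _ =>
    (hω i j).fourierMultiplier_moment
      (derivSymbol (e i) (dilate (2 ^ p) D.inverseLaplacianSymbol))) ((((2 : ℂ) ^ p) ^ 2)⁻¹)
  refine h.mono ?_
  simp only [derivSymbol_dilate hc, moment_smul, moment_dilate (show (0 : ℝ) < 2 ^ p by positivity)]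
  rw [← Finset.sum_mul, ← Finset.mul_sum, ← Finset.mul_sum]
  have h1 : ∑ i, moment 0 (derivSymbol (e i) D.inverseLaplacianSymbol) ≤ D.ellipticConst :=
    le_add_of_nonneg_right
      (Finset.sum_nonneg fun _ _ => Finset.sum_nonneg fun _ _ => moment_nonneg _ _)
  simp only [norm_inv, norm_pow, Complex.norm_real, Complex.norm_ofNat, Real.norm_ofNat, inv_pow]
  field_simp
  linarith [mul_le_mul_of_nonneg_right h1 hW]

/-- `‖∇ Δ_p v‖ ≤ C ‖ω‖` in `L^∞`. -/
theorem boundedBy_lineDeriv_block {v : Fin d → 𝓢'(E d, ℂ)} (hv : divergence v = 0) {W : ℝ}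
    (hW : 0 ≤ W) (hω : ∀ i j, BoundedBy (curl v i j) W) (p : ℕ) (j l : Fin d) :
    BoundedBy (∂_{(e l : E d)} (D.block p (v j))) (D.ellipticConst * W) := by
  have hc : (2 : ℝ) ^ p ≠ 0 := by positivity
  have heq : ∂_{(e l : E d)} (D.block p (v j)) = (((2 : ℂ) ^ p) ^ 2)⁻¹ • ∑ i,
      fourierMultiplierCLM ℂ (derivSymbol (e l) (derivSymbol (e i)
        (dilate (2 ^ p) D.inverseLaplacianSymbol))) (curl v i j) := by
    rw [D.block_eq_sum_curl hv, LineDeriv.lineDerivOp_smul, LineDeriv.lineDerivOp_sum]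
    simp only [lineDerivOp_fourierMultiplier]
  rw [heq]
  have h := BoundedBy.smul (BoundedBy.finset_sum (s := Finset.univ) fun i _ =>
    (hω i j).fourierMultiplier_moment
      (derivSymbol (e l) (derivSymbol (e i) (dilate (2 ^ p) D.inverseLaplacianSymbol))))
      ((((2 : ℂ) ^ p) ^ 2)⁻¹)
  refine h.mono ?_
  simp only [derivSymbol_dilate hc, derivSymbol_smul, moment_smul,
    moment_dilate (show (0 : ℝ) < 2 ^ p by positivity)]
  rw [← Finset.sum_mul, ← Finset.mul_sum, ← Finset.mul_sum, ← Finset.mul_sum]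
  have h1 : ∑ i, moment 0 (derivSymbol (e l) (derivSymbol (e i) D.inverseLaplacianSymbol)) ≤
      D.ellipticConst :=
    (Finset.single_le_sum (f := fun l => ∑ i, moment 0 (derivSymbol (e l) (derivSymbol (e i)
      D.inverseLaplacianSymbol)))
      (fun _ _ => Finset.sum_nonneg fun _ _ => moment_nonneg _ _) (Finset.mem_univ l)).trans
      (le_add_of_nonneg_left (Finset.sum_nonneg fun _ _ => moment_nonneg _ _))
  simp only [norm_inv, norm_pow, Complex.norm_real, Complex.norm_ofNat, Real.norm_ofNat]
  field_simp
  linarith [mul_le_mul_of_nonneg_right h1 hW]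

end DyadicPartition

/-! ### The regularity of the velocity -/

namespace DyadicPartition

variable (D : DyadicPartition d)

/-- A divergence free field with bounded vorticity is the sum of its low frequencies and of a
series of blocks which converges geometrically in `L^∞`. -/
theorem exists_velocity {v : Fin d → 𝓢'(E d, ℂ)} (hv : divergence v = 0) {W : ℝ} (hW : 0 ≤ W)
    (hω : ∀ i j, BoundedBy (curl v i j) W) (j : Fin d) :
    ∃ (a V : E d → ℂ) (b : ℕ → E d → ℂ), Represents a (D.block (-1) (v j)) ∧
      (∀ p : ℕ, Represents (b p) (D.block p (v j))) ∧ Represents V (v j) ∧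
      ∀ N, ∀ᵐ x, ‖V x - (a x + ∑ p ∈ Finset.range N, b p x)‖ ≤
        2 * (D.ellipticConst * W) * 2⁻¹ ^ N := by
  obtain ⟨a, ha⟩ := exists_represents_fourierMultiplier (D.blockSymbol (-1)) (v j)
  rw [← D.block_eq le_rfl] at ha
  choose b hb hbn using fun p => (D.boundedBy_block hv hW hω p j).exists_Lp
  have hbn' : ∀ p, ‖b p‖ ≤ D.ellipticConst * W * 2⁻¹ ^ p := fun p => by
    have h0 := D.ellipticConst_nonneg
    have := hbn p
    rwa [max_eq_left (by positivity)] at this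
  have hsum : Summable b := Summable.of_norm_bounded
    ((summable_geometric_of_lt_one (by norm_num) (by norm_num)).mul_left _) hbn'
  set B := ∑' p, b p with hB
  have hrep : ∀ p, Represents (b p) (D.block p (v j)) := fun p => by
    rw [← hb p]
    exact represents_toTemperedDistribution _
  have hBrep := represents_toTemperedDistribution B
  have hS : ∀ N, Lp.toTemperedDistribution (B - ∑ p ∈ Finset.range N, b p) =
      Lp.toTemperedDistribution B - ∑ p ∈ Finset.range N, D.block p (v j) := fun N => by
    have := map_sub (Lp.toTemperedDistributionCLM ℂ (volume : Measure (E d)) ⊤) B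
      (∑ p ∈ Finset.range N, b p)
    rw [map_sum] at this
    simp only [Lp.toTemperedDistributionCLM_apply, hb] at this
    exact this
  have hvB : D.block (-1) (v j) + Lp.toTemperedDistribution B = v j := by
    ext ψ
    have h1 := D.tendsto_sum_block (v j) ψ
    have h2 := hsum.hasSum.tendsto_sum_nat
    have h3 := ((PointwiseConvergenceCLM.evalCLM (RingHom.id ℂ) ℂ ψ).continuous.tendsto _).comp
      (((Lp.toTemperedDistributionCLM ℂ (volume : Measure (E d)) ⊤).continuous.tendsto _).comp h2)
    -- the partial sums converge to `v_j` as distributions and to the sum of the series in `L^∞`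
    have h4 := h3.const_add (D.block (-1) (v j) ψ)
    refine tendsto_nhds_unique (h4.congr fun N => ?_) h1
    simp only [Function.comp, map_sum, Lp.toTemperedDistributionCLM_apply, hb]
    simp
    rfl
  refine ⟨a, fun x => a x + B x, fun p => b p, ha, hrep, ?_, fun N => ?_⟩
  · have := ha.add hBrep
    rwa [hvB] at this
  · have h1 := represents_toTemperedDistribution (B - ∑ p ∈ Finset.range N, b p)
    rw [hS] at h1
    have h2 := hBrep.sub (Represents.finset_sum (s := Finset.range N) fun p _ => hrep p)
    have h3 := norm_sub_le_of_geometric_bound_of_hasSum (by norm_num : (2 : ℝ)⁻¹ < 1) hbn'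
      hsum.hasSum N
    rw [norm_sub_rev] at h3
    filter_upwards [h1.ae_eq h2, ae_norm_le_norm_Lp (B - ∑ p ∈ Finset.range N, b p)] with x hx hn
    rw [hx] at hn
    rw [add_sub_add_left_eq_sub]
    refine hn.trans (h3.trans (le_of_eq ?_))
    norm_num
    ring

/-- For every `N`, the velocity is the sum of a function with Lipschitz constant `O(M + N W)`, its
frequencies below `2^N`, and of a function bounded by `O(2^{-N} W)`. -/
theorem exists_velocity_modulus {v : Fin d → 𝓢'(E d, ℂ)} (hv : divergence v = 0) {W : ℝ}
    (hW : 0 ≤ W) (hω : ∀ i j, BoundedBy (curl v i j) W) {j : Fin d} {V : E d → ℂ}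
    (hV : Represents V (v j)) {M : ℝ} (hM : 0 ≤ M)
    (hgrad : ∀ i, BoundedBy (∂_{(e i : E d)} (D.block (-1) (v j))) M) (N : ℕ) :
    ∃ s : Set (E d), (∀ᵐ x, x ∈ s) ∧ ∀ x ∈ s, ∀ y ∈ s,
      ‖V x - V y‖ ≤ d * (M + N * (D.ellipticConst * W)) * ‖x - y‖ +
        4 * (D.ellipticConst * W) * 2⁻¹ ^ N := by
  obtain ⟨a, V', b, ha, hb, hV', hN⟩ := D.exists_velocity hv hW hω j
  have hA := ha.add (Represents.finset_sum (s := Finset.range N) fun p _ => hb p)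
  have h0 := D.ellipticConst_nonneg
  obtain ⟨s, hs, hlip⟩ := hA.exists_lipschitz (M := M + N * (D.ellipticConst * W)) (by positivity)
    fun i => by
      rw [LineDeriv.lineDerivOp_add, LineDeriv.lineDerivOp_sum]
      have := BoundedBy.finset_sum (s := Finset.range N) fun p _ =>
        D.boundedBy_lineDeriv_block hv hW hω p j i
      simpa using (hgrad i).add this
  refine ⟨{x | x ∈ s ∧ V x = V' x ∧ ‖V' x - (a x + ∑ p ∈ Finset.range N, b p x)‖ ≤
    2 * (D.ellipticConst * W) * 2⁻¹ ^ N}, ?_, ?_⟩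
  · filter_upwards [hs, hV.ae_eq hV', hN N] with x h1 h2 h3 using ⟨h1, h2, h3⟩
  · rintro x ⟨hx1, hx2, hx3⟩ y ⟨hy1, hy2, hy3⟩
    have h := hlip x hx1 y hy1
    rw [hx2, hy2]
    rw [norm_sub_rev] at hy3
    calc ‖V' x - V' y‖ = ‖(V' x - (a x + ∑ p ∈ Finset.range N, b p x)) +
          ((a x + ∑ p ∈ Finset.range N, b p x) - (a y + ∑ p ∈ Finset.range N, b p y)) +
          ((a y + ∑ p ∈ Finset.range N, b p y) - V' y)‖ := by congr 1; ring
      _ ≤ _ := norm_add₃_le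
      _ ≤ _ := by linarith

/-- A bound for the moments of order `0` and `1` of the kernels `∂_i 𝓕⁻ χ` and `∂_i 𝓕⁻ φ`. -/
noncomputable def kernelConst : ℝ :=
  ∑ i, ∑ n ∈ Finset.range 2, (moment n (derivSymbol (e i) D.lowSymbol) +
    moment n (derivSymbol (e i) D.shellSymbol))

theorem moment_le_kernelConst (i : Fin d) {n : ℕ} (hn : n < 2) :
    moment n (derivSymbol (e i) D.lowSymbol) + moment n (derivSymbol (e i) D.shellSymbol) ≤
      D.kernelConst := by
  have h0 : ∀ i n, 0 ≤ moment n (derivSymbol (e i) D.lowSymbol) +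
      moment n (derivSymbol (e i) D.shellSymbol) := fun i n =>
    add_nonneg (moment_nonneg _ _) (moment_nonneg _ _)
  refine le_trans ?_ (Finset.single_le_sum (f := fun i => ∑ n ∈ Finset.range 2,
    (moment n (derivSymbol (e i) D.lowSymbol) + moment n (derivSymbol (e i) D.shellSymbol)))
    (fun i _ => Finset.sum_nonneg fun n _ => h0 i n) (Finset.mem_univ i))
  exact Finset.single_le_sum (f := fun n => moment n (derivSymbol (e i) D.lowSymbol) +
    moment n (derivSymbol (e i) D.shellSymbol)) (fun n _ => h0 i n) (Finset.mem_range.2 hn)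

theorem kernelConst_nonneg : 0 ≤ D.kernelConst :=
  Finset.sum_nonneg fun _ _ => Finset.sum_nonneg fun _ _ =>
    add_nonneg (moment_nonneg _ _) (moment_nonneg _ _)

/-- The derivative of the kernel of `Δ_q` costs a factor `2^q`, which the first moment gives
back. -/
theorem moment_one_blockSymbol_le {q : ℤ} (hq : -1 ≤ q) (i : Fin d) :
    moment 1 (derivSymbol (e i) (D.blockSymbol q)) ≤ D.kernelConst := by
  have h := D.moment_le_kernelConst i (n := 1) (by norm_num)
  have h1 := moment_nonneg 1 (derivSymbol (e i) D.lowSymbol)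
  have h2 := moment_nonneg 1 (derivSymbol (e i) D.shellSymbol)
  rcases eq_or_lt_of_le hq with rfl | hq
  · rw [blockSymbol_neg_one]
    linarith
  · obtain ⟨p, rfl⟩ := Int.eq_ofNat_of_zero_le (show 0 ≤ q by omega)
    have hp : (0 : ℝ) < 2 ^ p := by positivity
    have : moment 1 (derivSymbol (e i) (D.blockSymbol p)) =
        moment 1 (derivSymbol (e i) D.shellSymbol) := by
      rw [blockSymbol_natCast, derivSymbol_dilate hp.ne', moment_smul, moment_dilate hp,
        Complex.norm_real, Real.norm_of_nonneg hp.le]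
      field_simp
    simp only [this]
    linarith

theorem moment_zero_blockSymbol_le {q : ℤ} (hq : -1 ≤ q) (i : Fin d) :
    moment 0 (derivSymbol (e i) (D.blockSymbol q)) ≤ D.kernelConst * 2 ^ (q + 1).toNat := by
  have h := D.moment_le_kernelConst i (n := 0) (by norm_num)
  have h1 := moment_nonneg 0 (derivSymbol (e i) D.lowSymbol)
  have h2 := moment_nonneg 0 (derivSymbol (e i) D.shellSymbol)
  rcases eq_or_lt_of_le hq with rfl | hq
  · rw [blockSymbol_neg_one]
    simp
    linarith
  · obtain ⟨p, rfl⟩ := Int.eq_ofNat_of_zero_le (show 0 ≤ q by omega)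
    have hp : (0 : ℝ) < 2 ^ p := by positivity
    have : moment 0 (derivSymbol (e i) (D.blockSymbol p)) =
        2 ^ p * moment 0 (derivSymbol (e i) D.shellSymbol) := by
      rw [blockSymbol_natCast, derivSymbol_dilate hp.ne', moment_smul, moment_dilate hp,
        Complex.norm_real, Real.norm_of_nonneg hp.le]
      simp
    have h3 : ((p : ℤ) + 1).toNat = p + 1 := by omega
    simp only [this, h3, pow_succ]
    nlinarith

end DyadicPartition

/-! ### The advection term -/

/-- The product `v · ∇u` is `div (u v)`, as `div v = 0`. -/
theorem isAdvection_of_divergence_eq_zero {v : Fin d → 𝓢'(E d, ℂ)} (hv : divergence v = 0)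
    {V : Fin d → E d → ℂ} (hV : ∀ i, Represents (V i) (v i)) {u : E d → ℂ}
    (hu : ContDiff ℝ ((⊤ : ℕ∞) : WithTop ℕ∞) u) {T : 𝓢'(E d, ℂ)} (hT : Represents u T)
    {S : Fin d → 𝓢'(E d, ℂ)} (hS : ∀ i, Represents (fun x => V i x * u x) (S i)) :
    IsAdvection v T (∑ i, ∂_{(e i : E d)} (S i)) := by
  refine ⟨u, hu, fun ψ _ => hT.2 ψ, fun ψ ρ hψ hρ => ?_⟩
  set ψu : 𝓢(E d, ℂ) := HasCompactSupport.toSchwartzMap (f := fun x => ψ x * u x) hψ.mul_right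
    ((ψ.smooth ⊤).mul hu) with hψu
  have hderiv : ∀ i x, (∂_{(e i : E d)} ψu : 𝓢(E d, ℂ)) x =
      (∂_{(e i : E d)} ψ : 𝓢(E d, ℂ)) x * u x + ρ i x := fun i x => by
    rw [SchwartzMap.lineDerivOp_apply_eq_fderiv, SchwartzMap.lineDerivOp_apply_eq_fderiv, hρ]
    have h1 : HasFDerivAt (fun x => ψ x * u x) _ x :=
      (ψ.hasFDerivAt x).mul (hu.differentiable (by simp) x).hasFDerivAt
    have h2 : fderiv ℝ ψu x = _ := h1.fderiv
    rw [h2]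
    simp
    ring
  have hsplit : ∀ i, v i (∂_{(e i : E d)} ψu) = S i (∂_{(e i : E d)} ψ) + v i (ρ i) := fun i => by
    rw [(hV i).2, (hV i).2, (hS i).2, ← integral_add ((hS i).1.integrable_mul _)
      ((hV i).1.integrable_mul _)]
    refine integral_congr_ae (.of_forall fun x => ?_)
    simp only [hderiv]
    ring
  have hdiv : ∑ i, v i (∂_{(e i : E d)} ψu) = 0 := by
    have := congrArg (fun A : 𝓢'(E d, ℂ) => A ψu) hv
    simpa [divergence] using this
  simp only [hsplit, Finset.sum_add_distrib] at hdiv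
  have hP : (∑ i, ∂_{(e i : E d)} (S i)) ψ = - ∑ i, S i (∂_{(e i : E d)} ψ) := by
    simp
  rw [hP, neg_eq_iff_add_eq_zero, hdiv]

/-- For a smooth function `k * u`, the product `v · ∇(k * u)` is a pointwise product. -/
theorem isAdvection_conv {v : Fin d → 𝓢'(E d, ℂ)} {V : Fin d → E d → ℂ}
    (hV : ∀ i, Represents (V i) (v i)) {u : E d → ℂ} (hu : TemperedFun u) {k : 𝓢(E d, ℂ)}
    {T Q : 𝓢'(E d, ℂ)} (hT : Represents (conv k u) T)
    (hQ : Represents (fun x => ∑ i, V i x * conv (∂_{(e i : E d)} k : 𝓢(E d, ℂ)) u x) Q) :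
    IsAdvection v T Q := by
  refine ⟨_, hu.contDiff_conv k, fun ψ _ => hT.2 ψ, fun ψ ρ _ hρ => ?_⟩
  rw [hQ.2]
  have h : ∀ i, v i (ρ i) = ∫ x, ρ i x * V i x := fun i => (hV i).2 _
  simp only [h]
  rw [← integral_finsetSum _ fun i _ => (hV i).1.integrable_mul _]
  refine integral_congr_ae (.of_forall fun x => ?_)
  simp only [hρ, hu.fderiv_conv, Finset.mul_sum]
  exact Finset.sum_congr rfl fun i _ => by ring

/-! ### The commutator estimate -/

/-- The commutator of a convolution with the multiplication by `V` has the kernel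
`k (x - y) (V y - V x)`, so that a modulus of continuity of `V` combines with the moments of `k`. -/
theorem norm_conv_mul_sub_mul_conv_le {V u : E d → ℂ} (hV : TemperedFun V)
    (hum : AEStronglyMeasurable u volume) {U L ε : ℝ} (hu : ∀ᵐ x, ‖u x‖ ≤ U)
    {s : Set (E d)} (hs : ∀ᵐ x, x ∈ s)
    (hVs : ∀ x ∈ s, ∀ y ∈ s, ‖V x - V y‖ ≤ L * ‖x - y‖ + ε) (G : 𝓢(E d, ℂ)) :
    ∀ᵐ x, ‖conv (𝓕⁻ G : 𝓢(E d, ℂ)) (fun y => V y * u y) x -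
      V x * conv (𝓕⁻ G : 𝓢(E d, ℂ)) u x‖ ≤ (L * moment 1 G + ε * moment 0 G) * U := by
  set k : 𝓢(E d, ℂ) := 𝓕⁻ G with hk
  have hut : TemperedFun u := TemperedFun.of_bounded hum hu
  have hVu : TemperedFun (fun y => V y * u y) := hV.mul_bounded hum hu
  filter_upwards [hs] with x hx
  have heq : conv k (fun y => V y * u y) x - V x * conv k u x =
      ∫ y, k (x - y) * (V y - V x) * u y := by
    simp only [conv]
    rw [← integral_const_mul, ← integral_sub (hVu.integrable_conv k x)
      ((hut.integrable_conv k x).const_mul _)]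
    exact integral_congr_ae (.of_forall fun y => by ring)
  have hi : ∀ n : ℕ, Integrable fun y => ‖y‖ ^ n * ‖k y‖ := fun n => k.integrable_pow_mul volume n
  have hi1 : ∀ n : ℕ, Integrable fun y => ‖x - y‖ ^ n * ‖k (x - y)‖ :=
    fun n => (hi n).comp_sub_left x
  have hint : ∀ n : ℕ, ∫ y, ‖x - y‖ ^ n * ‖k (x - y)‖ = moment n G := fun n => by
    rw [moment, ← integral_sub_left_eq_self (fun y => ‖y‖ ^ n * ‖k y‖) volume x]
  rw [heq]
  calc _ ≤ ∫ y, (L * (‖x - y‖ ^ 1 * ‖k (x - y)‖) + ε * (‖x - y‖ ^ 0 * ‖k (x - y)‖)) * U := by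
        refine norm_integral_le_of_norm_le
          ((((hi1 1).const_mul L).add ((hi1 0).const_mul ε)).mul_const U) ?_
        filter_upwards [hs, hu] with y hy huy
        rw [norm_mul, norm_mul]
        have h1 := hVs y hy x hx
        rw [norm_sub_rev y x] at h1
        calc ‖k (x - y)‖ * ‖V y - V x‖ * ‖u y‖ ≤ ‖k (x - y)‖ * (L * ‖x - y‖ + ε) * U := by
              gcongr
              exact mul_nonneg (norm_nonneg _) ((norm_nonneg _).trans h1)
          _ = _ := by ring
    _ = _ := by
        rw [integral_mul_const, integral_add ((hi1 1).const_mul L) ((hi1 0).const_mul ε),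
          integral_const_mul, integral_const_mul, hint, hint]

namespace DyadicPartition

variable (D : DyadicPartition d)

/-- The derivatives in `div (u v)` and in `∇ Δ_q u` both fall on the kernel of `Δ_q`, so that the
commutator is a sum of commutators of convolutions with multiplications. -/
theorem represents_commutator {V : Fin d → E d → ℂ} {u : E d → ℂ}
    {S : Fin d → 𝓢'(E d, ℂ)} (hS : ∀ i, Represents (fun x => V i x * u x) (S i)) {q : ℤ}
    (hq : -1 ≤ q) {Q : 𝓢'(E d, ℂ)}
    (hQ : Represents (fun x => ∑ i, V i x *
      conv (𝓕⁻ (derivSymbol (e i) (D.blockSymbol q)) : 𝓢(E d, ℂ)) u x) Q) :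
    Represents (fun x => ∑ i,
        (conv (𝓕⁻ (derivSymbol (e i) (D.blockSymbol q)) : 𝓢(E d, ℂ)) (fun y => V i y * u y) x -
          V i x * conv (𝓕⁻ (derivSymbol (e i) (D.blockSymbol q)) : 𝓢(E d, ℂ)) u x))
      (D.block q (∑ i, ∂_{(e i : E d)} (S i)) - Q) := by
  simp only [Finset.sum_sub_distrib]
  refine Represents.sub ?_ hQ
  rw [D.block_eq hq, map_sum]
  simp only [← fourierMultiplier_derivSymbol]
  exact Represents.finset_sum fun i _ => (hS i).fourierMultiplier _

/-- The commutator estimate, in terms of bounds on the velocity and on `u`. -/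
theorem boundedBy_commutator {v : Fin d → 𝓢'(E d, ℂ)} (hv : divergence v = 0) {W : ℝ} (hW : 0 ≤ W)
    (hω : ∀ i j, BoundedBy (curl v i j) W) {V : Fin d → E d → ℂ}
    (hV : ∀ i, Represents (V i) (v i)) {M : ℝ} (hM : 0 ≤ M)
    (hgrad : ∀ i j, BoundedBy (∂_{(e i : E d)} (D.block (-1) (v j))) M) {u : E d → ℂ}
    (hum : AEStronglyMeasurable u volume) {U : ℝ} (hu : ∀ᵐ x, ‖u x‖ ≤ U) (hU : 0 ≤ U)
    {S : Fin d → 𝓢'(E d, ℂ)} (hS : ∀ i, Represents (fun x => V i x * u x) (S i)) {q : ℤ}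
    (hq : -1 ≤ q) {Q : 𝓢'(E d, ℂ)}
    (hQ : Represents (fun x => ∑ i, V i x *
      conv (𝓕⁻ (derivSymbol (e i) (D.blockSymbol q)) : 𝓢(E d, ℂ)) u x) Q) :
    BoundedBy (D.block q (∑ i, ∂_{(e i : E d)} (S i)) - Q)
      (d * D.kernelConst * (d + d * D.ellipticConst + 4 * D.ellipticConst) * U *
        (M + ((q : ℝ) + 2) * W)) := by
  -- the velocity is split at the frequency `2^N` of the block, with `N = q + 1 ≥ 0`
  obtain ⟨N, hN⟩ : ∃ N : ℕ, (N : ℤ) = q + 1 := ⟨(q + 1).toNat, by omega⟩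
  have hNq : (q + 1).toNat = N := by omega
  have hqN : (q : ℝ) + 2 = N + 1 := by
    have : ((N : ℤ) : ℝ) = ((q + 1 : ℤ) : ℝ) := by rw [hN]
    push_cast at this
    linarith
  have hK := D.kernelConst_nonneg
  have hE := D.ellipticConst_nonneg
  refine ⟨_, D.represents_commutator hS hq hQ, ?_⟩
  have hcomp : ∀ i, ∀ᵐ x, ‖conv (𝓕⁻ (derivSymbol (e i) (D.blockSymbol q)) : 𝓢(E d, ℂ))
      (fun y => V i y * u y) x -
        V i x * conv (𝓕⁻ (derivSymbol (e i) (D.blockSymbol q)) : 𝓢(E d, ℂ)) u x‖ ≤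
      D.kernelConst * (d + d * D.ellipticConst + 4 * D.ellipticConst) * U *
        (M + (N + 1) * W) := fun i => by
    obtain ⟨s, hs, hVs⟩ := D.exists_velocity_modulus hv hW hω (hV i) hM (fun l => hgrad l i) N
    filter_upwards [norm_conv_mul_sub_mul_conv_le (hV i).1 hum hu hs hVs
      (derivSymbol (e i) (D.blockSymbol q))] with x hx
    refine hx.trans ?_
    have h1 := D.moment_one_blockSymbol_le hq i
    have h0 := D.moment_zero_blockSymbol_le hq i
    rw [hNq] at h0
    have h2 : (2 : ℝ)⁻¹ ^ N * 2 ^ N = 1 := by rw [← mul_pow]; simp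
    calc _ ≤ (d * (M + N * (D.ellipticConst * W)) * D.kernelConst +
          4 * (D.ellipticConst * W) * 2⁻¹ ^ N * (D.kernelConst * 2 ^ N)) * U := by
          gcongr
      _ = D.kernelConst * (d * M + d * D.ellipticConst * (N * W) + 4 * D.ellipticConst * W) *
            U := by
          linear_combination (4 * (D.ellipticConst * W) * D.kernelConst * U) * h2
      _ ≤ D.kernelConst * ((d + d * D.ellipticConst + 4 * D.ellipticConst) *
          (M + (N + 1) * W)) * U := by
          gcongr
          have e1 : 0 ≤ (N : ℝ) * W := by positivity
          have e2 : 0 ≤ d * D.ellipticConst := by positivity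
          have e3 : (0 : ℝ) ≤ d := by positivity
          nlinarith [mul_nonneg e2 hM, mul_nonneg e2 hW, mul_nonneg e3 e1, mul_nonneg e3 hW,
            mul_nonneg hE hM, mul_nonneg hE e1]
      _ = _ := by ring
  have hall := ae_all_iff.2 hcomp
  filter_upwards [hall] with x hx
  refine (norm_sum_le_of_le _ fun i _ => hx i).trans (le_of_eq ?_)
  rw [Finset.sum_const, hqN]
  simp
  ring

end DyadicPartition

theorem linftyMatrixNorm_lt_top {A : Fin d → Fin d → 𝓢'(E d, ℂ)}
    (h : ∀ i j, linftyNorm (A i j) < ⊤) : linftyMatrixNorm A < ⊤ := by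
  have : linftyMatrixNorm A ≤ ∑ i, ∑ j, linftyNorm (A i j) :=
    iSup₂_le fun i j => (Finset.single_le_sum (f := fun j => linftyNorm (A i j))
      (fun _ _ => zero_le) (Finset.mem_univ j)).trans
      (Finset.single_le_sum (f := fun i => ∑ j, linftyNorm (A i j))
        (fun _ _ => zero_le) (Finset.mem_univ i))
  exact this.trans_lt (by simp [ENNReal.sum_lt_top, h])

theorem boundedBy_of_linftyMatrixNorm_lt_top {A : Fin d → Fin d → 𝓢'(E d, ℂ)}
    (h : linftyMatrixNorm A < ⊤) (i j : Fin d) : BoundedBy (A i j) (linftyMatrixNorm A).toReal := by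
  have hle : linftyNorm (A i j) ≤ linftyMatrixNorm A :=
    le_iSup₂ (f := fun i j => linftyNorm (A i j)) i j
  exact (boundedBy_of_linftyNorm_lt_top (hle.trans_lt h)).mono (ENNReal.toReal_mono h.ne hle)

end

end LittlewoodPaley

open LittlewoodPaley in
theorem propositionB (d : ℕ) (D : LittlewoodPaley.DyadicPartition d) :
    ∃ C : ℝ≥0,
      ∀ (v : Fin d → 𝓢'(LittlewoodPaley.E d, ℂ)) (u : LittlewoodPaley.E d → ℂ)
        (_ : ContDiff ℝ ((⊤ : ℕ∞) : WithTop ℕ∞) u) (hu : MemLp u ⊤ volume),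
        LittlewoodPaley.divergence v = 0 →
        (∀ i j, LittlewoodPaley.linftyNorm (LittlewoodPaley.curl v i j) < ⊤) →
        ∃ P : 𝓢'(LittlewoodPaley.E d, ℂ),
          LittlewoodPaley.IsAdvection v (Lp.toTemperedDistribution (hu.toLp u)) P ∧
          ∀ q : ℤ, -1 ≤ q →
            ∃ Q : 𝓢'(LittlewoodPaley.E d, ℂ),
              LittlewoodPaley.IsAdvection v
                (D.block q (Lp.toTemperedDistribution (hu.toLp u))) Q ∧
              LittlewoodPaley.linftyNorm (D.block q P - Q) ≤
                C * eLpNorm u ⊤ volume *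
                  (LittlewoodPaley.linftyMatrixNorm
                      (LittlewoodPaley.grad fun i => D.block (-1) (v i)) +
                    ENNReal.ofReal ((q : ℝ) + 2) *
                      LittlewoodPaley.linftyMatrixNorm (LittlewoodPaley.curl v)) := by
  have hK := D.kernelConst_nonneg
  have hE := D.ellipticConst_nonneg
  -- the `1` makes the constant positive, so that the right-hand side is infinite when `∇Δ_{-1} v`
  -- is unbounded and `u ≠ 0`
  set C : ℝ := d * D.kernelConst * (d + d * D.ellipticConst + 4 * D.ellipticConst) + 1 with hC
  have hC1 : 0 < C := by positivity
  refine ⟨C.toNNReal, fun v u hsm hu hv hω => ?_⟩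
  have hωtop := linftyMatrixNorm_lt_top hω
  have hωb := boundedBy_of_linftyMatrixNorm_lt_top hωtop
  set W := (linftyMatrixNorm (curl v)).toReal with hW
  have hum := hu.aestronglyMeasurable
  set U := (eLpNorm u ⊤ volume).toReal with hU
  have hub : ∀ᵐ x, ‖u x‖ ≤ U := by
    filter_upwards [hu.coeFn_toLp, ae_norm_le_norm_Lp (hu.toLp u)] with x h1 h2
    rwa [h1, Lp.norm_toLp] at h2
  have hut : Represents u (Lp.toTemperedDistribution (hu.toLp u)) :=
    (represents_toTemperedDistribution _).congr_ae hu.coeFn_toLp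
  choose _ V _ _ _ hV _ using fun j => D.exists_velocity hv ENNReal.toReal_nonneg hωb j
  choose S hS using fun i => ((hV i).1.mul_bounded hum hub).exists_represents
  refine ⟨∑ i, ∂_{(e i : E d)} (S i), isAdvection_of_divergence_eq_zero hv hV hsm hut hS,
    fun q hq => ?_⟩
  have hQt : TemperedFun (fun x => ∑ i, V i x *
      conv (FourierTransformInv.fourierInv (derivSymbol (e i) (D.blockSymbol q)) : 𝓢(E d, ℂ))
        u x) :=
    TemperedFun.finset_sum fun i _ => (hV i).1.mul_bounded
      (hut.1.contDiff_conv _).continuous.aestronglyMeasurable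
      (.of_forall fun x => norm_conv_le hub x)
  obtain ⟨Q, hQ⟩ := hQt.exists_represents
  refine ⟨Q, isAdvection_conv hV hut.1 (k := FourierTransformInv.fourierInv (D.blockSymbol q))
    ?_ ?_, ?_⟩
  · rw [D.block_eq hq]
    exact hut.fourierMultiplier _
  · simpa only [lineDerivOp_fourierInv] using hQ
  by_cases hu0 : eLpNorm u ⊤ volume = 0
  · -- here the right-hand side is `0`, even if `∇Δ_{-1} v` is unbounded
    have huz : ∀ᵐ x, ‖u x‖ ≤ 0 := by
      rw [hU, hu0] at hub
      simpa using hub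
    refine (BoundedBy.linftyNorm_le (B := 0) ⟨_, D.represents_commutator hS hq hQ, ?_⟩
      le_rfl).trans (by simp)
    refine .of_forall fun x => le_of_eq (norm_eq_zero.2 (Finset.sum_eq_zero fun i _ => ?_))
    have h0 : ∀ (f : E d → ℂ) (k : 𝓢(E d, ℂ)), (∀ᵐ y, f y = 0) → conv k f x = 0 := fun f k hf =>
      integral_eq_zero_of_ae (by filter_upwards [hf] with y hy; simp [hy])
    rw [h0 u _ (huz.mono fun y hy => norm_le_zero_iff.1 hy),
      h0 _ _ (huz.mono fun y hy => by rw [norm_le_zero_iff.1 hy, mul_zero])]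
    simp
  · by_cases hgrad : linftyMatrixNorm (grad fun i => D.block (-1) (v i)) = ⊤
    · rw [hgrad, top_add, ENNReal.mul_top]
      · exact le_top
      · refine mul_ne_zero ?_ hu0
        simpa using hC1
    · set M := (linftyMatrixNorm (grad fun i => D.block (-1) (v i))).toReal with hM
      have hq2 : (0 : ℝ) ≤ (q : ℝ) + 2 := by
        have : ((-1 : ℤ) : ℝ) ≤ q := by exact_mod_cast hq
        push_cast at this
        linarith
      have hmain := D.boundedBy_commutator hv ENNReal.toReal_nonneg hωb hV
        (ENNReal.toReal_nonneg (a := linftyMatrixNorm (grad fun i => D.block (-1) (v i))))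
        (boundedBy_of_linftyMatrixNorm_lt_top (lt_top_iff_ne_top.2 hgrad)) hum hub
        ENNReal.toReal_nonneg hS hq hQ
      rw [← hM, ← hW] at hmain
      have hM0 : 0 ≤ M := ENNReal.toReal_nonneg
      have hW0 : 0 ≤ W := ENNReal.toReal_nonneg
      have hU0 : 0 ≤ U := ENNReal.toReal_nonneg
      have hfin := (hmain.mono (B := C * U * (M + ((q : ℝ) + 2) * W)) (by
        gcongr
        linarith)).linftyNorm_le (by positivity)
      refine hfin.trans (le_of_eq ?_)
      rw [ENNReal.ofReal_mul (by positivity), ENNReal.ofReal_mul (by positivity),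
        ENNReal.ofReal_add hM0 (by positivity), ENNReal.ofReal_mul hq2, hU, hM, hW,
        ENNReal.ofReal_toReal hu.2.ne, ENNReal.ofReal_toReal hgrad, ENNReal.ofReal_toReal hωtop.ne]
      rfl
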